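/- Let $k,\ell\ge 2$ be integers, let $c>0$ be real, and let $(m_n)_{n\ge1}$ be non-negative integers with $m_n/n\to c$ (for instance $m_n=\lfloor cn\rfloor$, or $m_n = cn$ when this is an integer). **The graphs $G_n=G_{n,m_n}^{k,\ell}$.** Choose $s_{i,j}\in\mathbb Z_n$ ($1\le i\le m_n$, $1\le j\le k$) independently and uniformly at random. $G_n$ is the random bipartite (multi)graph with vertex set $A_C\sqcup A_R\sqcup B$, where $A_C=\{c_i : i\in\mathbb Z_n\}$, $A_R=\{e_1,\dots,e_{m_n}\}$ and $B=\mathbb Z_n$. It is the incidence graph of the multisets $c_i=\{i,i+1\}$ and $e_i=\{s_{i,1},\dots,s_{i,k}\}$: the number of edges between $a\in A_C\cup A_R$ and $b\in B$ is the multiplicity of $b$ in $a$, and there are no other edges. Vertices in $A_C,A_R,B$ have weight $\ell-1$, $1$, $\ell$, respectively. $G_n(\circ)$ is $G_n$ rooted at a vertex chosen uniformly at random from all its vertices, independently of the $s_{i,j}$. **The tree $T=T_c^{k,\ell}$.** $T$ is the random rooted tree with vertices of types $A_C,A_R,B$ (of weights $\ell-1,1,\ell$, respectively), generated by independent random choices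 as follows. The root has type $A_C$, $A_R$, $B$ with probability $\frac1{2+c},\frac c{2+c},\frac1{2+c}$, respectively. A vertex of type $A_C$ has two children of type $B$ if it is the root, and one otherwise. A vertex of type $A_R$ has $k$ children of type $B$ if it is the root, and $k-1$ otherwise. A vertex of type $B$ has a $\mathrm{Poisson}(kc)$ number of children of type $A_R$ and, in addition, one child of type $A_C$ if its parent is of type $A_C$, and two children of type $A_C$ otherwise (that is, if it is the root or its parent is of type $A_R$). For a rooted graph $R$ and $d\in\mathbb N_0$, let $R|_d$ be the rooted subgraph induced by the vertices at distance at most $d$ from the root. Regard two rooted graphs as equal if there is a root-preserving isomorphism between them. **Claim.** $G_n$ converges locally weakly to $T$: for every $d\in\mathbb N_0$ and every rooted graph $H$, $$\lim_{n\to\infty}\Pr\big[G_n(\circ)|_d=H\big]=\Pr\big[T|_d=H\big].$$ This holds whichever of the edge multiplicities, the vertex types and the vertex weights the isomorphisms are required to preserve in addition to the root and adjacency (any subset of the three, including none; $H$ carries the corresponding data). -/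

import Mathlib

open Filter Topology MeasureTheory ProbabilityTheory
open scoped NNReal

namespace CuckooWindows

/-- The three kinds of vertices: helper edges `A_C`, ordinary edges `A_R`, and
table positions `B`. -/
inductive VType
  | helper
  | ordinary
  | table

/-- The vertex weights: `ℓ - 1` on `A_C`, `1` on `A_R`, `ℓ` on `B`. -/
def weightOf (ℓ : ℕ) : VType → ℕ
  | .helper => ℓ - 1
  | .ordinary => 1
  | .table => ℓ

/-- Rooted loopless multigraphs whose vertices carry a type and a weight.
`mult u v` is the number of parallel edges between `u` and `v`. -/
structure RootedGraph where
  V : Type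
  root : V
  mult : V → V → ℕ
  mult_symm : ∀ u v, mult u v = mult v u
  mult_self : ∀ v, mult v v = 0
  vtype : V → VType
  weight : V → ℕ

namespace RootedGraph

/-- The underlying simple graph. -/
def toSimpleGraph (R : RootedGraph) : SimpleGraph R.V where
  Adj u v := R.mult u v ≠ 0
  symm := ⟨fun u v h => by rw [R.mult_symm]; exact h⟩
  loopless := ⟨fun v h => h (R.mult_self v)⟩

/-- The rooted graph `R|_d`, induced by the vertices at distance at most `d` from the root.
The distance is `ℕ∞`-valued, with value `⊤` for vertices not connected to the root. -/
def ball (R : RootedGraph) (d : ℕ) : RootedGraph where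
  V := {v : R.V // R.toSimpleGraph.edist R.root v ≤ d}
  root := ⟨R.root, by simp⟩
  mult u v := R.mult u v
  mult_symm u v := R.mult_symm u v
  mult_self v := R.mult_self v
  vtype v := R.vtype v
  weight v := R.weight v

/-- Equality of rooted graphs up to isomorphism. An isomorphism always preserves the root and
adjacency; the flags say which further data it is required to preserve:
edge multiplicities, vertex types, vertex weights. -/
def Isom (keepMult keepType keepWeight : Prop) (R S : RootedGraph) : Prop :=
  ∃ f : R.V ≃ S.V, f R.root = S.root ∧
    (∀ u v, R.toSimpleGraph.Adj u v ↔ S.toSimpleGraph.Adj (f u) (f v)) ∧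
    (keepMult → ∀ u v, R.mult u v = S.mult (f u) (f v)) ∧
    (keepType → ∀ v, R.vtype v = S.vtype (f v)) ∧
    (keepWeight → ∀ v, R.weight v = S.weight (f v))

end RootedGraph

/-! ### The finite random graphs -/

/-- The vertex set `(A_C ∪ A_R) ∪ B`: the helper edges `c_i` (`i ∈ ℤ_n`), the ordinary edges
`e_1, …, e_m`, and the table positions `ℤ_n`. -/
abbrev GVertex (n m : ℕ) : Type := (ZMod n ⊕ Fin m) ⊕ ZMod n

/-- The type of a vertex. -/
def gType {n m : ℕ} : GVertex n m → VType
  | .inl (.inl _) => .helper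
  | .inl (.inr _) => .ordinary
  | .inr _ => .table

/-- The multiplicity of the table position `b` in a hyperedge: the helper edge `c_i` is the
multiset `{i, i + 1}` and the ordinary edge `e_i` is the multiset `{s i 1, …, s i k}`. -/
def incidence {n m k : ℕ} (s : Fin m → Fin k → ZMod n) : ZMod n ⊕ Fin m → ZMod n → ℕ
  | .inl i, b => (if b = i then 1 else 0) + (if b = i + 1 then 1 else 0)
  | .inr e, b => (Finset.univ.filter fun j => s e j = b).card

/-- The weighted incidence graph given by an outcome `s` of the choices of the ordinary edges,
rooted at the vertex `r`. -/
def incidenceGraph {n m k : ℕ} (ℓ : ℕ) (s : Fin m → Fin k → ZMod n) (r : GVertex n m) :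
    RootedGraph where
  V := GVertex n m
  root := r
  mult u v := match u, v with
    | .inl a, .inr b => incidence s a b
    | .inr b, .inl a => incidence s a b
    | _, _ => 0
  mult_symm u v := by rcases u with u | u <;> rcases v with v | v <;> rfl
  mult_self v := by rcases v with v | v <;> rfl
  vtype := gType
  weight v := weightOf ℓ (gType v)

/-- The probability of an event `P` for the random rooted graph `G_{n,m}^{k,ℓ}(∘)`: the `m * k`
elements of the ordinary edges are chosen independently and uniformly from `ℤ_n`, and the root
independently and uniformly from the vertices, i.e. all pairs `(s, r)` are equally likely. -/
noncomputable def graphProb (n m k ℓ : ℕ) (P : RootedGraph → Prop) : ℝ :=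
  (Nat.card {ω : (Fin m → Fin k → ZMod n) × GVertex n m // P (incidenceGraph ℓ ω.1 ω.2)} : ℝ) /
    (Nat.card ((Fin m → Fin k → ZMod n) × GVertex n m) : ℝ)

/-! ### The limiting random tree -/

/-- The list of types of the children of a vertex of type `t`, where `p` is the type of its parent
(`none` for the root) and `x` is the number of children of type `A_R` in case `t = B`. -/
def childTypes (k x : ℕ) (p : Option VType) (t : VType) : List VType :=
  match t, p with
  | .helper, none => List.replicate 2 .table
  | .helper, some _ => List.replicate 1 .table
  | .ordinary, none => List.replicate k .table
  | .ordinary, some _ => List.replicate (k - 1) .table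
  | .table, some .helper => List.replicate 1 .helper ++ List.replicate x .ordinary
  | .table, _ => List.replicate 2 .helper ++ List.replicate x .ordinary

/-- Vertices of the tree are addressed by lists: `[]` is the root and `i :: u` is the `i`-th child
of `u` (counting from `0`). For root type `t` and offspring numbers `X`, `nodeInfo k t X u` is
`none` if the tree has no vertex with address `u`, and otherwise it is the pair of the type of the
parent (`none` for the root) and the type of the vertex. -/
def nodeInfo (k : ℕ) (t : VType) (X : List ℕ → ℕ) : List ℕ → Option (Option VType × VType)
  | [] => some (none, t)
  | i :: u => (nodeInfo k t X u).bind fun q =>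
      ((childTypes k (X u) q.1 q.2)[i]?).map fun s => (some q.2, s)

/-- `u` is the address of the parent of `v`. -/
def IsParent (u v : List ℕ) : Prop := ∃ i, v = i :: u

open Classical in
/-- The weighted rooted tree with root type `t` and offspring numbers `X`. -/
noncomputable def tree (k ℓ : ℕ) (t : VType) (X : List ℕ → ℕ) : RootedGraph where
  V := {u : List ℕ // (nodeInfo k t X u).isSome}
  root := ⟨[], rfl⟩
  mult u v := if IsParent u.1 v.1 ∨ IsParent v.1 u.1 then 1 else 0
  mult_symm u v := by simp only [or_comm]
  mult_self v := by simp [IsParent]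
  vtype v := ((nodeInfo k t X v.1).get v.2).2
  weight v := weightOf ℓ ((nodeInfo k t X v.1).get v.2).2

instance : MeasurableSpace VType := ⊤

/-- The law of the type of the root. -/
noncomputable def rootLaw (c : ℝ≥0) : Measure VType :=
  (1 / (2 + c)) • Measure.dirac .helper + (c / (2 + c)) • Measure.dirac .ordinary +
    (1 / (2 + c)) • Measure.dirac .table

/-- The law of the random decisions behind the tree `T_c^{k,ℓ}`: the type of the root and,
independently, a family of independent Poisson variables with parameter `k c`, indexed by all
possible addresses. -/
noncomputable def treeLaw (k : ℕ) (c : ℝ≥0) : Measure (VType × (List ℕ → ℕ)) :=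
  (rootLaw c).prod (Measure.infinitePi fun _ : List ℕ => poissonMeasure (k * c))

/-- The probability of an event `P` for the random rooted tree `T_c^{k,ℓ}`. -/
noncomputable def treeProb (k ℓ : ℕ) (c : ℝ≥0) (P : RootedGraph → Prop) : ℝ :=
  (treeLaw k c).real {ω | P (tree k ℓ ω.1 ω.2)}

end CuckooWindows

/-!
Explore `G_n` from its root and record only how many ordinary edges each table position meets
besides the one it was reached from. As long as the exploration meets no vertex twice, the ball
around the root is the ball in the tree with these offspring numbers. Such a tree falls into
clusters, the paths of helper edges and table positions, each of which is an interval of the cycle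
`ℤ_n` fixed by the position of its head. If the tree has `o` ordinary edges, it has `1 + (k - 1) o`
clusters; placing these far apart, naming the ordinary edges, and letting all other ordinary edges
avoid the `b` positions used gives, in the limit, the lower bound
`c ^ o * exp (-b k c) / (2 + c)`, times a power of `k` and divided by factorials, for the
probability of this outcome. This is exactly the Poisson weight of the tree. As these weights have
total mass `1`, lower bounds suffice: nothing is left for collisions or for other shapes.
-/

namespace CuckooWindows

/-! ### Isomorphisms of rooted graphs -/

namespace RootedGraph

theorem Isom.symm {a b c : Prop} {R S : RootedGraph} (h : Isom a b c R S) : Isom a b c S R := by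
  obtain ⟨f, hroot, hadj, hmult, htype, hweight⟩ := h
  refine ⟨f.symm, by rw [← hroot, f.symm_apply_apply], fun u v => ?_, fun ha u v => ?_,
    fun hb v => ?_, fun hc v => ?_⟩
  · rw [hadj, f.apply_symm_apply, f.apply_symm_apply]
  · rw [hmult ha, f.apply_symm_apply, f.apply_symm_apply]
  · rw [htype hb, f.apply_symm_apply]
  · rw [hweight hc, f.apply_symm_apply]

theorem Isom.trans {a b c : Prop} {R S T : RootedGraph} (h : Isom a b c R S)
    (h' : Isom a b c S T) : Isom a b c R T := by
  obtain ⟨f, hroot, hadj, hmult, htype, hweight⟩ := h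
  obtain ⟨g, hroot', hadj', hmult', htype', hweight'⟩ := h'
  exact ⟨f.trans g, by simp [hroot, hroot'], fun u v => (hadj u v).trans (hadj' _ _),
    fun ha u v => (hmult ha u v).trans (hmult' ha _ _),
    fun hb v => (htype hb v).trans (htype' hb _),
    fun hc v => (hweight hc v).trans (hweight' hc _)⟩

theorem Isom.mono {a b c a' b' c' : Prop} {R S : RootedGraph} (ha : a' → a) (hb : b' → b)
    (hc : c' → c) (h : Isom a b c R S) : Isom a' b' c' R S := by
  obtain ⟨f, hroot, hadj, hmult, htype, hweight⟩ := h
  exact ⟨f, hroot, hadj, hmult ∘ ha, htype ∘ hb, hweight ∘ hc⟩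

theorem Isom.of_equiv {R S : RootedGraph} (f : R.V ≃ S.V) (hroot : f R.root = S.root)
    (hmult : ∀ u v, R.mult u v = S.mult (f u) (f v))
    (htype : ∀ v, R.vtype v = S.vtype (f v)) (hweight : ∀ v, R.weight v = S.weight (f v)) :
    Isom True True True R S :=
  ⟨f, hroot, fun u v => by simp only [toSimpleGraph, hmult], fun _ => hmult, fun _ => htype,
    fun _ => hweight⟩

theorem isom_ball_of_bijOn {R S : RootedGraph} {d : ℕ} (f : R.V → S.V)
    (hf : Set.BijOn f {v | R.toSimpleGraph.edist R.root v ≤ d}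
      {w | S.toSimpleGraph.edist S.root w ≤ d})
    (hroot : f R.root = S.root)
    (hmult : ∀ u v, R.toSimpleGraph.edist R.root u ≤ d → R.toSimpleGraph.edist R.root v ≤ d →
      R.mult u v = S.mult (f u) (f v))
    (htype : ∀ v, R.toSimpleGraph.edist R.root v ≤ d → R.vtype v = S.vtype (f v))
    (hweight : ∀ v, R.toSimpleGraph.edist R.root v ≤ d → R.weight v = S.weight (f v)) :
    Isom True True True (R.ball d) (S.ball d) :=
  .of_equiv (R := R.ball d) (S := S.ball d) (hf.equiv f) (Subtype.ext hroot)
    (fun u v => hmult u.1 v.1 u.2 v.2) (fun v => htype v.1 v.2) fun v => hweight v.1 v.2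

/-- A property of rooted graphs that depends only on the isomorphism class, for isomorphisms
preserving multiplicities, types and weights. -/
def IsomInvariant (P : RootedGraph → Prop) : Prop :=
  ∀ R S, Isom True True True R S → P R → P S

theorem IsomInvariant.iff {P : RootedGraph → Prop} (hP : IsomInvariant P) {R S : RootedGraph}
    (h : Isom True True True R S) : P R ↔ P S :=
  ⟨hP R S h, hP S R h.symm⟩

theorem isomInvariant_isom (a b c : Prop) (H : RootedGraph) :
    IsomInvariant fun R => Isom a b c R H :=
  fun _ _ h h' => (h.mono (fun _ => trivial) (fun _ => trivial) fun _ => trivial).symm.trans h'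

end RootedGraph

theorem le_add_edist {V : Type*} {G : SimpleGraph V} (f : V → ℕ)
    (hf : ∀ u v, G.Adj u v → f v ≤ f u + 1) (u v : V) : (f v : ℕ∞) ≤ f u + G.edist u v := by
  have of_walk {u v : V} (w : G.Walk u v) : f v ≤ f u + w.length := by
    induction w with
    | nil => simp
    | cons h w ih => grind [SimpleGraph.Walk.length_cons]
  by_cases h : G.edist u v = ⊤
  · simp [h]
  · obtain ⟨w, hw⟩ := SimpleGraph.exists_walk_of_edist_ne_top h
    rw [← hw]
    exact_mod_cast of_walk w

/-! ### Distances in the tree -/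

section Tree

variable {k ℓ : ℕ} {t : VType} {X : List ℕ → ℕ}

theorem nodeInfo_cons_eq_some {i : ℕ} {u : List ℕ} {q : Option VType} {a : VType} :
    nodeInfo k t X (i :: u) = some (q, a) ↔ ∃ p b, nodeInfo k t X u = some (p, b) ∧ q = some b ∧
      (childTypes k (X u) p b)[i]? = some a := by
  rw [nodeInfo]
  rcases nodeInfo k t X u with _ | ⟨p, b⟩
  · simp
  · simp only [Option.bind_some, Option.map_eq_some_iff, Prod.mk.injEq, Option.some.injEq]
    grind

theorem isSome_nodeInfo_of_cons {i : ℕ} {u : List ℕ} (h : (nodeInfo k t X (i :: u)).isSome) :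
    (nodeInfo k t X u).isSome := by
  obtain ⟨q, hq⟩ := Option.isSome_iff_exists.1 h
  obtain ⟨p, b, h, -⟩ := nodeInfo_cons_eq_some.1 hq
  simp [h]

theorem tree_adj {u v : (tree k ℓ t X).V} :
    (tree k ℓ t X).toSimpleGraph.Adj u v ↔ IsParent u.1 v.1 ∨ IsParent v.1 u.1 := by
  simp only [RootedGraph.toSimpleGraph, tree]
  split_ifs with h <;> simp [h]

theorem tree_edist_root_le (u : List ℕ) (hu : (nodeInfo k t X u).isSome) :
    (tree k ℓ t X).toSimpleGraph.edist (tree k ℓ t X).root ⟨u, hu⟩ ≤ u.length := by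
  induction u with
  | nil => exact (SimpleGraph.edist_self (G := (tree k ℓ t X).toSimpleGraph)).le
  | cons i u ih =>
    have hu' := isSome_nodeInfo_of_cons hu
    have hadj : (tree k ℓ t X).toSimpleGraph.Adj ⟨u, hu'⟩ ⟨i :: u, hu⟩ :=
      tree_adj.2 (.inl ⟨i, rfl⟩)
    rw [List.length_cons, Nat.cast_add, Nat.cast_one]
    exact (SimpleGraph.edist_triangle (v := ⟨u, hu'⟩)).trans
      (add_le_add (ih hu') (SimpleGraph.edist_eq_one_iff_adj.2 hadj).le)

theorem tree_edist_root (u : (tree k ℓ t X).V) :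
    (tree k ℓ t X).toSimpleGraph.edist (tree k ℓ t X).root u = u.1.length := by
  refine (tree_edist_root_le u.1 u.2).antisymm ?_
  have hlip : ∀ v w, (tree k ℓ t X).toSimpleGraph.Adj v w → w.1.length ≤ v.1.length + 1 := by
    intro v w h
    rcases tree_adj.1 h with ⟨i, hi⟩ | ⟨i, hi⟩ <;> simp only [hi, List.length_cons] <;> omega
  have hroot : (tree k ℓ t X).root.1 = [] := rfl
  exact (le_add_edist (fun v : (tree k ℓ t X).V => v.1.length) hlip (tree k ℓ t X).root u).trans_eq
    (by rw [hroot]; exact zero_add _)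

theorem tree_edist_root_le_iff {u : (tree k ℓ t X).V} {d : ℕ} :
    (tree k ℓ t X).toSimpleGraph.edist (tree k ℓ t X).root u ≤ d ↔ u.1.length ≤ d := by
  rw [tree_edist_root, Nat.cast_le]

end Tree

/-! ### Unfolding the incidence graph -/

theorem eq_or_eq_iff_of_eq_or_eq {G : Type*} [AddCommGroup G] {x y a b : G}
    (ha : a = x ∨ a = y) : b = x ∨ b = y ↔ b = x + y - a ∨ b = a := by
  rcases ha with rfl | rfl
  · rw [add_sub_cancel_left, or_comm]
  · rw [add_sub_cancel_right]

theorem injective_of_injective_comp_succAbove {α : Type*} {k : ℕ} {f : Fin (k + 1) → α}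
    (j : Fin (k + 1)) (hf : Function.Injective (f ∘ j.succAbove))
    (hj : ∀ i, f (j.succAbove i) ≠ f j) : Function.Injective f := by
  intro x y hxy
  induction x using Fin.succAboveCases j <;> induction y using Fin.succAboveCases j
  · rfl
  · exact absurd hxy.symm (hj _)
  · exact absurd hxy (hj _)
  · exact congrArg _ (hf hxy)

section Unfolding

variable {n m k : ℕ} {s : Fin m → Fin (k + 1) → ZMod n}

/-- Adjacency in the incidence graph, which depends neither on the weights nor on the root. -/
def Incident (s : Fin m → Fin (k + 1) → ZMod n) (v w : GVertex n m) : Prop :=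
  (incidenceGraph 0 s v).mult v w ≠ 0

theorem Incident.symm {v w : GVertex n m} (h : Incident s v w) : Incident s w v :=
  fun h' => h (((incidenceGraph 0 s v).mult_symm v w).trans h')

theorem incidenceGraph_adj {ℓ : ℕ} {r v w : GVertex n m} :
    (incidenceGraph ℓ s r).toSimpleGraph.Adj v w ↔ Incident s v w :=
  Iff.rfl

theorem not_incident_inl_inl {a b : ZMod n ⊕ Fin m} : ¬ Incident s (.inl a) (.inl b) :=
  fun h => h rfl

theorem not_incident_inr_inr {a b : ZMod n} : ¬ Incident s (.inr a) (.inr b) :=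
  fun h => h rfl

theorem incident_helper_table {i b : ZMod n} :
    Incident s (.inl (.inl i)) (.inr b) ↔ b = i ∨ b = i + 1 := by
  change incidence s (.inl i) b ≠ 0 ↔ _
  simp only [incidence]
  split_ifs <;> simp_all

theorem incident_ordinary_table {e : Fin m} {b : ZMod n} :
    Incident s (.inl (.inr e)) (.inr b) ↔ ∃ j, s e j = b := by
  change incidence s (.inr e) b ≠ 0 ↔ _
  simp [incidence, Finset.filter_eq_empty_iff]

theorem incident_table_helper {i b : ZMod n} :
    Incident s (.inr b) (.inl (.inl i)) ↔ i = b ∨ i = b - 1 := by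
  rw [show Incident s (.inr b) (.inl (.inl i)) ↔ Incident s (.inl (.inl i)) (.inr b) from
    ⟨.symm, .symm⟩, incident_helper_table, eq_comm, eq_sub_iff_add_eq, eq_comm (a := b)]

theorem incident_table_ordinary {e : Fin m} {b : ZMod n} :
    Incident s (.inr b) (.inl (.inr e)) ↔ ∃ j, s e j = b :=
  ⟨fun h => incident_ordinary_table.1 h.symm, fun h => (incident_ordinary_table.2 h).symm⟩

/-- The position of a helper edge `c_i` or of a table position `i` on the cycle `ℤ_n`. An ordinary
edge has no position; it gets the value `0`. -/
def coord : GVertex n m → ZMod n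
  | .inl (.inl i) => i
  | .inl (.inr _) => 0
  | .inr b => b

open Classical in
/-- A slot of the ordinary edge `e` in which `b` occurs, and `0` if there is none. -/
noncomputable def parentSlot (s : Fin m → Fin (k + 1) → ZMod n) (e : Fin m) (b : ZMod n) :
    Fin (k + 1) :=
  if h : ∃ j, s e j = b then h.choose else 0

theorem apply_parentSlot {e : Fin m} {b : ZMod n} (h : ∃ j, s e j = b) :
    s e (parentSlot s e b) = b := by
  rw [parentSlot, dif_pos h]
  exact h.choose_spec

/-- The ordinary edges through `b` other than the parent `p`. -/
def ordinaryChildren (s : Fin m → Fin (k + 1) → ZMod n) (p : Option (GVertex n m))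
    (b : ZMod n) : Finset (Fin m) :=
  Finset.univ.filter fun e => (∃ j, s e j = b) ∧ p ≠ some (.inl (.inr e))

/-- The helper edges through `b` other than the parent `p`. The helper edges through `b` are `c_b`
and `c_{b-1}`, so if one of them is the parent `c_h` then the other one is `c_{2b-1-h}`. -/
def helperChildren (p : Option (GVertex n m)) (b : ZMod n) : List (GVertex n m) :=
  match p with
  | some (.inl (.inl h)) => [.inl (.inl (2 * b - 1 - h))]
  | _ => [.inl (.inl b), .inl (.inl (b - 1))]

/-- The list of the neighbours of a vertex other than its parent `p` (`none` for the root), in the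
order of the types in `childTypes`. -/
noncomputable def children (s : Fin m → Fin (k + 1) → ZMod n) :
    Option (GVertex n m) → GVertex n m → List (GVertex n m)
  | none, .inl (.inl i) => [.inr i, .inr (i + 1)]
  | some p, .inl (.inl i) => [.inr (2 * i + 1 - coord p)]
  | none, .inl (.inr e) => List.ofFn fun j => .inr (s e j)
  | some p, .inl (.inr e) =>
      List.ofFn fun i : Fin k => .inr (s e ((parentSlot s e (coord p)).succAbove i))
  | p, .inr b => helperChildren p b ++
      ((ordinaryChildren s p b).sort (· ≤ ·)).map fun e => .inl (.inr e)

/-- The number of ordinary edges among the children of a vertex with parent `p`, counted only for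
table positions. -/
def ordinaryCount (s : Fin m → Fin (k + 1) → ZMod n) (p : Option (GVertex n m)) :
    GVertex n m → ℕ
  | .inr b => (ordinaryChildren s p b).card
  | .inl _ => 0

/-- The non-backtracking walk from `r` with a given address, as the pair of its last two
vertices. Addresses are read as in `nodeInfo`: the walk `i :: u` continues the walk `u` to the
`i`-th child of its endpoint. -/
noncomputable def walk (s : Fin m → Fin (k + 1) → ZMod n) (r : GVertex n m) :
    List ℕ → Option (Option (GVertex n m) × GVertex n m)
  | [] => some (none, r)
  | i :: u => (walk s r u).bind fun q => ((children s q.1 q.2)[i]?).map fun v => (some q.2, v)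

/-- The number of ordinary edges continuing the walk with a given address. -/
noncomputable def offspring (s : Fin m → Fin (k + 1) → ZMod n) (r : GVertex n m)
    (u : List ℕ) : ℕ :=
  (walk s r u).elim 0 fun q => ordinaryCount s q.1 q.2

theorem map_gType_children (p : Option (GVertex n m)) (v : GVertex n m) :
    (children s p v).map gType =
      childTypes (k + 1) (ordinaryCount s p v) (p.map gType) (gType v) := by
  rcases v with (i | e) | b
  · rcases p with _ | p <;> simp [children, childTypes, gType]
  · rcases p with _ | p <;> simp only [children, childTypes, gType, List.map_ofFn,
      Option.map_none, Option.map_some] <;> exact List.ofFn_const _ _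
  · have hordinary : (List.map gType (((ordinaryChildren s p b).sort (· ≤ ·)).map
        fun e => (Sum.inl (Sum.inr e) : GVertex n m))) =
        List.replicate (ordinaryChildren s p b).card .ordinary := by
      rw [List.map_map, List.eq_replicate_iff]
      simp [gType]
    rcases p with _ | ((p | p) | p) <;>
      simpa [children, childTypes, helperChildren, gType, ordinaryCount] using hordinary

theorem nodeInfo_offspring (r : GVertex n m) (u : List ℕ) :
    nodeInfo (k + 1) (gType r) (offspring s r) u =
      (walk s r u).map fun q => (q.1.map gType, gType q.2) := by
  induction u with
  | nil => rfl
  | cons i u ih =>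
    rw [nodeInfo, walk, ih, offspring]
    rcases walk s r u with _ | ⟨p, v⟩
    · rfl
    · simp only [Option.map_some, Option.bind_some, Option.elim_some]
      rw [← map_gType_children, List.getElem?_map, Option.map_map, Option.map_map]
      rfl

theorem incident_helper_iff {p : Option (GVertex n m)} {i : ZMod n} {w : GVertex n m}
    (hp : ∀ a, p = some a → Incident s (.inl (.inl i)) a) :
    Incident s (.inl (.inl i)) w ↔ w ∈ children s p (.inl (.inl i)) ∨ p = some w := by
  rcases w with w | b
  · simp only [not_incident_inl_inl, false_iff, not_or]
    exact ⟨by rcases p with _ | p <;> simp [children],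
      fun h => not_incident_inl_inl (hp _ h)⟩
  rw [incident_helper_table]
  rcases p with _ | (a | a)
  · simp [children]
  · exact absurd (hp _ rfl) not_incident_inl_inl
  · rw [eq_or_eq_iff_of_eq_or_eq (incident_helper_table.1 (hp _ rfl)), ← add_assoc, ← two_mul]
    simp [children, coord, eq_comm]

theorem incident_ordinary_iff {p : Option (GVertex n m)} {e : Fin m} {w : GVertex n m}
    (hp : ∀ a, p = some a → Incident s (.inl (.inr e)) a) :
    Incident s (.inl (.inr e)) w ↔ w ∈ children s p (.inl (.inr e)) ∨ p = some w := by
  rcases w with w | b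
  · simp only [not_incident_inl_inl, false_iff, not_or]
    exact ⟨by rcases p with _ | p <;> simp [children, -List.ofFn_succ],
      fun h => not_incident_inl_inl (hp _ h)⟩
  rw [incident_ordinary_table]
  rcases p with _ | (a | a)
  · simp [children, -List.ofFn_succ]
  · exact absurd (hp _ rfl) not_incident_inl_inl
  · have hslot := apply_parentSlot (incident_ordinary_table.1 (hp _ rfl))
    rw [Fin.exists_iff_succAbove (parentSlot s e a), hslot]
    simp [children, coord, or_comm]

theorem mem_children_table {p : Option (GVertex n m)} {b : ZMod n} {w : GVertex n m} :
    w ∈ children s p (.inr b) ↔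
      w ∈ helperChildren p b ∨ ∃ e ∈ ordinaryChildren s p b, w = .inl (.inr e) := by
  simp [children, eq_comm]

theorem incident_table_iff {p : Option (GVertex n m)} {b : ZMod n} {w : GVertex n m}
    (hp : ∀ a, p = some a → Incident s (.inr b) a) :
    Incident s (.inr b) w ↔ w ∈ children s p (.inr b) ∨ p = some w := by
  rw [mem_children_table]
  rcases w with (i | e) | b'
  · rw [incident_table_helper]
    rcases p with _ | ((a | a) | a)
    · simp [helperChildren]
    · rw [eq_or_eq_iff_of_eq_or_eq (incident_table_helper.1 (hp _ rfl)),
        ← add_sub_assoc, ← two_mul]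
      simp [helperChildren, eq_comm]
    · simp [helperChildren]
    · exact absurd (hp _ rfl) not_incident_inr_inr
  · rw [incident_table_ordinary]
    have hhelper : (.inl (.inr e) : GVertex n m) ∉ helperChildren p b := by
      rcases p with _ | ((a | a) | a) <;> simp [helperChildren]
    have hparent (h : p = some (.inl (.inr e))) : ∃ j, s e j = b :=
      incident_table_ordinary.1 (hp _ h)
    simp only [hhelper, ordinaryChildren, Finset.mem_filter, Finset.mem_univ, true_and,
      Sum.inl.injEq, Sum.inr.injEq]
    grind
  · simp only [not_incident_inr_inr, false_iff, not_or]
    refine ⟨⟨?_, by simp⟩, fun h => not_incident_inr_inr (hp _ h)⟩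
    rcases p with _ | ((a | a) | a) <;> simp [helperChildren]

theorem incident_iff_mem_children {p : Option (GVertex n m)} {v w : GVertex n m}
    (hp : ∀ a, p = some a → Incident s v a) :
    Incident s v w ↔ w ∈ children s p v ∨ p = some w :=
  match v with
  | .inl (.inl _) => incident_helper_iff hp
  | .inl (.inr _) => incident_ordinary_iff hp
  | .inr _ => incident_table_iff hp

variable {r : GVertex n m}

theorem walk_nil_eq_some {p : Option (GVertex n m)} {v : GVertex n m} :
    walk s r [] = some (p, v) ↔ p = none ∧ v = r := by
  simp [walk, eq_comm]

theorem walk_cons_eq_some {i : ℕ} {u : List ℕ} {q : Option (GVertex n m)} {w : GVertex n m} :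
    walk s r (i :: u) = some (q, w) ↔ ∃ p v, walk s r u = some (p, v) ∧ q = some v ∧
      (children s p v)[i]? = some w := by
  rw [walk]
  rcases walk s r u with _ | ⟨p, v⟩
  · simp
  · simp only [Option.bind_some, Option.map_eq_some_iff, Prod.mk.injEq, Option.some.injEq]
    grind

theorem walk_incident {u : List ℕ} {p : Option (GVertex n m)} {v : GVertex n m}
    (h : walk s r u = some (p, v)) : ∀ a, p = some a → Incident s v a := by
  induction u generalizing p v with
  | nil => simp [(walk_nil_eq_some.1 h).1]
  | cons i u ih =>
    obtain ⟨p, v, hu, rfl, hi⟩ := walk_cons_eq_some.1 h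
    rintro a ⟨⟩
    exact ((incident_iff_mem_children (ih hu)).2 (.inl (List.mem_of_getElem? hi))).symm

theorem walk_incident_parent {u v : List ℕ} {p q : Option (GVertex n m)} {a b : GVertex n m}
    (huv : IsParent u v) (hu : walk s r u = some (p, a)) (hv : walk s r v = some (q, b)) :
    Incident s a b := by
  obtain ⟨i, rfl⟩ := huv
  obtain ⟨p', a', hu', rfl, -⟩ := walk_cons_eq_some.1 hv
  obtain ⟨rfl, rfl⟩ : p = p' ∧ a = a' := by simpa [hu] using hu'
  exact (walk_incident hv _ rfl).symm

theorem exists_walk_of_incident {u : List ℕ} {p : Option (GVertex n m)} {v w : GVertex n m}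
    (hu : walk s r u = some (p, v)) (h : Incident s v w) :
    ∃ u' p', walk s r u' = some (p', w) ∧ (IsParent u u' ∨ IsParent u' u) := by
  rcases (incident_iff_mem_children (walk_incident hu)).1 h with hw | rfl
  · obtain ⟨i, hi⟩ := List.mem_iff_getElem?.1 hw
    exact ⟨i :: u, some v, walk_cons_eq_some.2 ⟨p, v, hu, rfl, hi⟩, .inl ⟨i, rfl⟩⟩
  · cases u with
    | nil => simp [walk] at hu
    | cons i u =>
      obtain ⟨p, a, hu', ⟨⟩, -⟩ := walk_cons_eq_some.1 hu
      exact ⟨u, p, hu', .inr ⟨i, rfl⟩⟩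

end Unfolding

/-! ### Balls without collisions are trees -/

section Ball

variable {n m k ℓ : ℕ} {s : Fin m → Fin (k + 1) → ZMod n} {r : GVertex n m}

theorem exists_walk_of_graphWalk {a b : (incidenceGraph ℓ s r).V}
    (w : (incidenceGraph ℓ s r).toSimpleGraph.Walk a b) {u : List ℕ}
    {p : Option (GVertex n m)} (hu : walk s r u = some (p, a)) :
    ∃ v q, walk s r v = some (q, b) ∧ v.length ≤ u.length + w.length := by
  induction w generalizing u p with
  | nil => exact ⟨u, p, hu, le_rfl⟩
  | cons h w ih =>
    obtain ⟨v, q, hv, hp⟩ := exists_walk_of_incident hu (incidenceGraph_adj.1 h)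
    obtain ⟨v', q', hv', hl⟩ := ih hv
    refine ⟨v', q', hv', ?_⟩
    rw [SimpleGraph.Walk.length_cons]
    rcases hp with ⟨i, rfl⟩ | ⟨i, rfl⟩ <;> simp only [List.length_cons] at * <;> omega

theorem exists_walk_of_edist_le {d : ℕ} {v : (incidenceGraph ℓ s r).V}
    (hv : (incidenceGraph ℓ s r).toSimpleGraph.edist (incidenceGraph ℓ s r).root v ≤ d) :
    ∃ u p, walk s r u = some (p, v) ∧ u.length ≤ d := by
  obtain ⟨w, hw⟩ := SimpleGraph.exists_walk_of_edist_ne_top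
    (hv.trans_lt (ENat.natCast_lt_top d)).ne
  obtain ⟨u, p, hu, hul⟩ := exists_walk_of_graphWalk w (u := []) (p := none) rfl
  rw [← hw, Nat.cast_le] at hv
  rw [List.length_nil, zero_add] at hul
  exact ⟨u, p, hu, hul.trans hv⟩

theorem edist_le_of_walk {u : List ℕ} {p : Option (GVertex n m)} {v : GVertex n m}
    (hu : walk s r u = some (p, v)) :
    (incidenceGraph ℓ s r).toSimpleGraph.edist (incidenceGraph ℓ s r).root v ≤ u.length := by
  induction u generalizing p v with
  | nil =>
    obtain ⟨-, rfl⟩ := walk_nil_eq_some.1 hu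
    exact (SimpleGraph.edist_self (G := (incidenceGraph ℓ s v).toSimpleGraph)).le
  | cons i u ih =>
    obtain ⟨p, a, ha, rfl, -⟩ := walk_cons_eq_some.1 hu
    have hadj : (incidenceGraph ℓ s r).toSimpleGraph.Adj a v :=
      incidenceGraph_adj.2 (walk_incident_parent ⟨i, rfl⟩ ha hu)
    rw [List.length_cons, Nat.cast_add, Nat.cast_one]
    exact (SimpleGraph.edist_triangle (v := a)).trans
      (add_le_add (ih ha) (SimpleGraph.edist_eq_one_iff_adj.2 hadj).le)

/-- There are no collisions up to depth `L`: the non-backtracking walks of length at most `L` end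
in distinct vertices. -/
def WalkInjective (s : Fin m → Fin (k + 1) → ZMod n) (r : GVertex n m) (L : ℕ) : Prop :=
  ∀ ⦃u v p q x⦄, u.length ≤ L → v.length ≤ L → walk s r u = some (p, x) →
    walk s r v = some (q, x) → u = v

section

variable {L : ℕ} (hL : WalkInjective s r L)
include hL

theorem WalkInjective.isParent_of_incident {u v : List ℕ} {p q : Option (GVertex n m)}
    {a b : GVertex n m} (hu : walk s r u = some (p, a)) (hv : walk s r v = some (q, b))
    (hul : u.length < L) (hvl : v.length ≤ L) (h : Incident s a b) :
    IsParent u v ∨ IsParent v u := by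
  obtain ⟨v', p', hv', hp⟩ := exists_walk_of_incident hu h
  have hv'l : v'.length ≤ L := by
    rcases hp with ⟨i, rfl⟩ | ⟨i, rfl⟩ <;> simp only [List.length_cons] at * <;> omega
  exact hL hv'l hvl hv' hv ▸ hp

theorem WalkInjective.eq_of_getElem?_children {u : List ℕ} {p : Option (GVertex n m)}
    {v w : GVertex n m} (hu : walk s r u = some (p, v)) (hul : u.length < L) {i j : ℕ}
    (hi : (children s p v)[i]? = some w) (hj : (children s p v)[j]? = some w) : i = j := by
  have := hL (u := i :: u) (v := j :: u) hul hul (walk_cons_eq_some.2 ⟨p, v, hu, rfl, hi⟩)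
    (walk_cons_eq_some.2 ⟨p, v, hu, rfl, hj⟩)
  simpa using this

theorem WalkInjective.parent_notMem_children {u : List ℕ} {v a : GVertex n m}
    (hu : walk s r u = some (some a, v)) (hul : u.length < L) : a ∉ children s (some a) v := by
  intro ha
  obtain ⟨j, hj⟩ := List.mem_iff_getElem?.1 ha
  cases u with
  | nil => simp [walk] at hu
  | cons i u =>
    obtain ⟨p, b, hb, ⟨⟩, -⟩ := walk_cons_eq_some.1 hu
    have hju := walk_cons_eq_some.2 ⟨_, _, hu, rfl, hj⟩
    have := congrArg List.length (hL (u := j :: i :: u) hul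
      (by rw [List.length_cons] at hul; omega) hju hb)
    simp only [List.length_cons] at this
    omega

theorem WalkInjective.slots_injective {u : List ℕ} {p : Option (GVertex n m)} {e : Fin m}
    (hu : walk s r u = some (p, .inl (.inr e))) (hul : u.length < L) :
    Function.Injective (s e) := by
  rcases p with _ | (a | a)
  · intro j j' hjj
    refine Fin.ext (hL.eq_of_getElem?_children hu hul (w := .inr (s e j)) ?_ ?_) <;>
      simp [children, hjj, -List.ofFn_succ] <;> omega
  · exact absurd (walk_incident hu _ rfl) not_incident_inl_inl
  · have hslot := apply_parentSlot (incident_ordinary_table.1 (walk_incident hu _ rfl))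
    refine injective_of_injective_comp_succAbove (parentSlot s e a) (fun i i' hii => ?_) ?_
    · refine Fin.ext (hL.eq_of_getElem?_children hu hul
        (w := .inr (s e ((parentSlot s e a).succAbove i))) ?_ ?_) <;> simp_all [children, coord]
    · intro i hi
      refine hL.parent_notMem_children hu hul ?_
      simp only [children, coord, List.mem_ofFn, Sum.inr.injEq]
      exact ⟨i, hi.trans hslot⟩

theorem WalkInjective.mult_le_one (hn : 2 ≤ n) {u v : List ℕ} {p q : Option (GVertex n m)}
    {a b : GVertex n m} (hu : walk s r u = some (p, a)) (hv : walk s r v = some (q, b))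
    (hul : u.length < L) (hvl : v.length < L) : (incidenceGraph ℓ s r).mult a b ≤ 1 := by
  have : Fact (1 < n) := ⟨hn⟩
  have helper_le (i b : ZMod n) : incidence s (.inl i) b ≤ 1 := by
    simp only [incidence]
    split_ifs with h h'
    · exact absurd (h.symm.trans h') (by simp)
    all_goals simp
  have ordinary_le {e : Fin m} (b : ZMod n) (he : Function.Injective (s e)) :
      incidence s (.inr e) b ≤ 1 :=
    Finset.card_le_one.2 fun j hj j' hj' => he (by simp_all)
  match a, b with
  | .inl _, .inl _ => exact Nat.zero_le _
  | .inr _, .inr _ => exact Nat.zero_le _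
  | .inl (.inl _), .inr _ => exact helper_le _ _
  | .inr _, .inl (.inl _) => exact helper_le _ _
  | .inl (.inr _), .inr _ => exact ordinary_le _ (hL.slots_injective hu hul)
  | .inr _, .inl (.inr _) => exact ordinary_le _ (hL.slots_injective hv hvl)

theorem WalkInjective.tree_mult_eq (hn : 2 ≤ n)
    {u v : (tree (k + 1) ℓ (gType r) (offspring s r)).V} {p q : Option (GVertex n m)}
    {a b : GVertex n m} (hu : walk s r u.1 = some (p, a)) (hv : walk s r v.1 = some (q, b))
    (hul : u.1.length < L) (hvl : v.1.length < L) :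
    (tree (k + 1) ℓ (gType r) (offspring s r)).mult u v = (incidenceGraph ℓ s r).mult a b := by
  have hiff : IsParent u.1 v.1 ∨ IsParent v.1 u.1 ↔ Incident s a b :=
    ⟨fun h => h.elim (walk_incident_parent · hu hv) fun h => (walk_incident_parent h hv hu).symm,
      hL.isParent_of_incident hu hv hul hvl.le⟩
  by_cases h : Incident s a b
  · exact (if_pos (hiff.2 h)).trans
      ((hL.mult_le_one hn hu hv hul hvl).antisymm (Nat.one_le_iff_ne_zero.2 h)).symm
  · exact (if_neg (mt hiff.1 h)).trans (not_not.1 h).symm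

end

theorem isSome_walk (u : (tree (k + 1) ℓ (gType r) (offspring s r)).V) :
    (walk s r u.1).isSome := by
  have hu := u.2
  rwa [nodeInfo_offspring, Option.isSome_map] at hu

/-- The vertex of the incidence graph reached by the walk with a given address. -/
noncomputable def endpoint (u : (tree (k + 1) ℓ (gType r) (offspring s r)).V) : GVertex n m :=
  ((walk s r u.1).get (isSome_walk u)).2

theorem walk_eq_some_endpoint (u : (tree (k + 1) ℓ (gType r) (offspring s r)).V) :
    ∃ p, walk s r u.1 = some (p, endpoint u) :=
  ⟨_, (Option.some_get (isSome_walk u)).symm⟩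

theorem tree_vtype_eq (u : (tree (k + 1) ℓ (gType r) (offspring s r)).V) :
    (tree (k + 1) ℓ (gType r) (offspring s r)).vtype u = gType (endpoint u) := by
  simp [tree, endpoint, nodeInfo_offspring, Option.get_map]

theorem endpoint_eq_of_walk {u : (tree (k + 1) ℓ (gType r) (offspring s r)).V}
    {p : Option (GVertex n m)} {v : GVertex n m} (hu : walk s r u.1 = some (p, v)) :
    endpoint u = v := by
  simp [endpoint, hu]

theorem WalkInjective.bijOn_endpoint {L d : ℕ} (hL : WalkInjective s r L) (hd : d ≤ L) :
    Set.BijOn endpoint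
      {u | (tree (k + 1) ℓ (gType r) (offspring s r)).toSimpleGraph.edist
        (tree (k + 1) ℓ (gType r) (offspring s r)).root u ≤ d}
      {v | (incidenceGraph ℓ s r).toSimpleGraph.edist (incidenceGraph ℓ s r).root v ≤ d} := by
  refine ⟨fun u hu => ?_, fun u hu v hv huv => ?_, fun v hv => ?_⟩
  · obtain ⟨p, hp⟩ := walk_eq_some_endpoint u
    exact (edist_le_of_walk hp).trans (Nat.cast_le.2 (tree_edist_root_le_iff.1 hu))
  · obtain ⟨p, hp⟩ := walk_eq_some_endpoint u
    obtain ⟨q, hq⟩ := walk_eq_some_endpoint v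
    exact Subtype.ext (hL ((tree_edist_root_le_iff.1 hu).trans hd)
      ((tree_edist_root_le_iff.1 hv).trans hd) hp (huv ▸ hq))
  · obtain ⟨u, p, hu, hul⟩ := exists_walk_of_edist_le hv
    have hnode : (nodeInfo (k + 1) (gType r) (offspring s r) u).isSome := by
      rw [nodeInfo_offspring, hu]
      rfl
    exact ⟨⟨u, hnode⟩, tree_edist_root_le_iff.2 hul, endpoint_eq_of_walk hu⟩

theorem WalkInjective.isom_ball {d : ℕ} (hL : WalkInjective s r (d + 1)) (hn : 2 ≤ n) :
    RootedGraph.Isom True True True ((tree (k + 1) ℓ (gType r) (offspring s r)).ball d)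
      ((incidenceGraph ℓ s r).ball d) := by
  refine RootedGraph.isom_ball_of_bijOn (S := incidenceGraph ℓ s r) endpoint
    (hL.bijOn_endpoint d.le_succ) (endpoint_eq_of_walk rfl) (fun u v hu hv => ?_)
    (fun u _ => tree_vtype_eq u) fun u _ => congrArg (weightOf ℓ) (tree_vtype_eq u)
  obtain ⟨p, hp⟩ := walk_eq_some_endpoint u
  obtain ⟨q, hq⟩ := walk_eq_some_endpoint v
  exact hL.tree_mult_eq hn hp hq (Nat.lt_succ_of_le (tree_edist_root_le_iff.1 hu))
    (Nat.lt_succ_of_le (tree_edist_root_le_iff.1 hv))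

end Ball

/-! ### Truncated trees -/

section Truncation

variable (k L : ℕ) (t : VType)

theorem finite_nodes (X : List ℕ → ℕ) :
    {u : List ℕ | u.length ≤ L ∧ (nodeInfo k t X u).isSome}.Finite := by
  induction L with
  | zero => exact (Set.finite_singleton []).subset fun u hu => by simpa using hu.1
  | succ L ih =>
    let childrenOf (u : List ℕ) : Set (List ℕ) := (· :: u) '' {i | (nodeInfo k t X u).any
      fun q => i < (childTypes k (X u) q.1 q.2).length}
    have hfinite (u : List ℕ) : (childrenOf u).Finite := by
      refine Set.Finite.image _ ?_
      rcases nodeInfo k t X u with _ | q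
      · simp
      · exact (Set.finite_lt_nat _).subset fun i hi => by simpa using hi
    refine ((ih.biUnion fun u _ => hfinite u).union (Set.finite_singleton [])).subset ?_
    rintro (_ | ⟨i, u⟩) ⟨hu, hs⟩
    · exact .inr rfl
    · obtain ⟨q, hq⟩ := Option.isSome_iff_exists.1 hs
      obtain ⟨p, a, hnode, -, hi⟩ := nodeInfo_cons_eq_some.1 hq
      refine .inl (Set.mem_biUnion (x := u) ⟨by simpa using hu, by simp [hnode]⟩ ⟨i, ?_, rfl⟩)
      simpa [hnode] using (List.getElem?_eq_some_iff.1 hi).1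

theorem finite_tables (X : List ℕ → ℕ) :
    {u : List ℕ | u.length < L ∧ ∃ p, nodeInfo k t X u = some (p, .table)}.Finite :=
  (finite_nodes k L t X).subset fun _ ⟨h, _, hp⟩ => ⟨h.le, by simp [hp]⟩

/-- The vertices of type `B` at depth less than `L`. -/
noncomputable def tables (X : List ℕ → ℕ) : Finset (List ℕ) :=
  (finite_tables k L t X).toFinset

/-- The offspring numbers of the vertices of type `B` at depth less than `L`, and `0` elsewhere:
these determine the tree up to depth `L`. -/
noncomputable def trunc (X : List ℕ → ℕ) : List ℕ →₀ ℕ :=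
  Finsupp.indicator (tables k L t X) fun u _ => X u

variable {k L t}

theorem mem_tables {X : List ℕ → ℕ} {u : List ℕ} :
    u ∈ tables k L t X ↔ u.length < L ∧ ∃ p, nodeInfo k t X u = some (p, .table) := by
  simp [tables]

theorem trunc_of_mem {X : List ℕ → ℕ} {u : List ℕ} (h : u ∈ tables k L t X) :
    trunc k L t X u = X u :=
  Finsupp.indicator_of_mem h _

theorem trunc_of_notMem {X : List ℕ → ℕ} {u : List ℕ} (h : u ∉ tables k L t X) :
    trunc k L t X u = 0 :=
  Finsupp.indicator_of_notMem h _

theorem childTypes_congr {x y : ℕ} {p : Option VType} {a : VType} (h : a = .table → x = y) :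
    childTypes k x p a = childTypes k y p a := by
  cases a with
  | table => rw [h rfl]
  | _ => rcases p with _ | _ <;> rfl

section

variable {X Y : List ℕ → ℕ} (h : ∀ u ∈ tables k L t X, Y u = X u)
include h

theorem nodeInfo_congr {u : List ℕ} (hu : u.length ≤ L) :
    nodeInfo k t Y u = nodeInfo k t X u := by
  induction u with
  | nil => rfl
  | cons i u ih =>
    rw [List.length_cons] at hu
    rw [nodeInfo, nodeInfo, ih (by omega)]
    refine Option.bind_congr fun q hq => ?_
    rw [childTypes_congr fun hq2 => h u (mem_tables.2 ⟨by omega, q.1, by rw [hq, ← hq2]⟩)]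

theorem tables_congr : tables k L t Y = tables k L t X := by
  ext u
  simp only [mem_tables]
  exact and_congr_right fun hu => by rw [nodeInfo_congr h hu.le]

theorem trunc_congr : trunc k L t Y = trunc k L t X := by
  ext u
  by_cases hu : u ∈ tables k L t X
  · rw [trunc_of_mem hu, trunc_of_mem (by rwa [tables_congr h]), h u hu]
  · rw [trunc_of_notMem hu, trunc_of_notMem (by rwa [tables_congr h])]

end

theorem tables_trunc (X : List ℕ → ℕ) : tables k L t (trunc k L t X) = tables k L t X :=
  tables_congr fun _ => trunc_of_mem

theorem trunc_trunc (X : List ℕ → ℕ) : trunc k L t (trunc k L t X) = trunc k L t X :=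
  trunc_congr fun _ => trunc_of_mem

theorem trunc_eq_iff {x : List ℕ →₀ ℕ} (hx : trunc k L t x = x) {X : List ℕ → ℕ} :
    trunc k L t X = x ↔ ∀ u ∈ tables k L t x, X u = x u := by
  constructor
  · rintro rfl u hu
    rw [tables_trunc] at hu
    exact (trunc_of_mem hu).symm
  · intro h
    rw [trunc_congr h, hx]

theorem isom_ball_trunc (ℓ : ℕ) {d : ℕ} (hd : d ≤ L) (X : List ℕ → ℕ) :
    RootedGraph.Isom True True True ((tree k ℓ t X).ball d)
      ((tree k ℓ t (trunc k L t X)).ball d) := by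
  have hnode {u : List ℕ} (hu : u.length ≤ d) :
      nodeInfo k t (trunc k L t X) u = nodeInfo k t X u :=
    nodeInfo_congr (fun _ => trunc_of_mem) (hu.trans hd)
  let f : ((tree k ℓ t X).ball d).V ≃ ((tree k ℓ t (trunc k L t X)).ball d).V :=
    { toFun := fun u => ⟨⟨u.1.1, by rw [hnode (tree_edist_root_le_iff.1 u.2)]; exact u.1.2⟩,
        tree_edist_root_le_iff.2 (tree_edist_root_le_iff (u := u.1).1 u.2)⟩
      invFun := fun u => ⟨⟨u.1.1, by rw [← hnode (tree_edist_root_le_iff.1 u.2)]; exact u.1.2⟩,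
        tree_edist_root_le_iff.2 (tree_edist_root_le_iff (u := u.1).1 u.2)⟩
      left_inv := fun _ => rfl
      right_inv := fun _ => rfl }
  have htype (u) : ((tree k ℓ t X).ball d).vtype u =
      ((tree k ℓ t (trunc k L t X)).ball d).vtype (f u) := by
    have hu := hnode (tree_edist_root_le_iff.1 u.2)
    change ((nodeInfo k t X u.1.1).get _).2 = ((nodeInfo k t (trunc k L t X) u.1.1).get _).2
    simp only [hu]
  exact .of_equiv f rfl (fun _ _ => rfl) htype fun u => congrArg (weightOf ℓ) (htype u)

end Truncation

/-- A depth greater than `d` at which all vertices have type `B`, for a given root type. -/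
def levelOf (d : ℕ) : VType → ℕ
  | .table => 2 * d + 2
  | _ => 2 * d + 1

theorem lt_levelOf (d : ℕ) (t : VType) : d < levelOf d t := by
  cases t <;> simp only [levelOf] <;> omega

/-- A possible shape of the tree up to depth `levelOf d`, encoded by the type of the root and the
offspring numbers of the vertices of type `B` above that depth. -/
@[ext]
structure TreePrefix (k d : ℕ) where
  rootType : VType
  offspring : List ℕ →₀ ℕ
  trunc_eq : trunc k (levelOf d rootType) rootType offspring = offspring

/-- The shape of the tree with root type `t` and offspring numbers `X`. -/
noncomputable def prefixOf (k d : ℕ) (t : VType) (X : List ℕ → ℕ) : TreePrefix k d :=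
  ⟨t, trunc k (levelOf d t) t X, trunc_trunc X⟩

namespace TreePrefix

variable {k d : ℕ}

/-- The depth up to which the tree is described. -/
abbrev depth (y : TreePrefix k d) : ℕ := levelOf d y.rootType

/-- The vertices of type `B` whose offspring numbers are recorded. -/
noncomputable abbrev tables (y : TreePrefix k d) : Finset (List ℕ) :=
  CuckooWindows.tables k y.depth y.rootType y.offspring

theorem prefixOf_eq_iff {t : VType} {X : List ℕ → ℕ} {y : TreePrefix k d} :
    prefixOf k d t X = y ↔ t = y.rootType ∧ ∀ u ∈ y.tables, X u = y.offspring u := by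
  rw [TreePrefix.ext_iff]
  refine and_congr_right ?_
  rintro (rfl : t = y.rootType)
  exact trunc_eq_iff y.trunc_eq

instance : Countable (TreePrefix k d) := by
  have : Finite VType := Set.finite_univ_iff.1
    ((Set.toFinite {VType.helper, .ordinary, .table}).subset fun t _ => by cases t <;> simp)
  exact Function.Injective.countable (f := fun y : TreePrefix k d => (y.rootType, y.offspring))
    fun y y' h => TreePrefix.ext (congrArg Prod.fst h) (congrArg Prod.snd h)

theorem isom_ball_prefixOf (ℓ : ℕ) (t : VType) (X : List ℕ → ℕ) :
    RootedGraph.Isom True True True ((tree k ℓ t X).ball d)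
      ((tree k ℓ (prefixOf k d t X).rootType (prefixOf k d t X).offspring).ball d) :=
  isom_ball_trunc ℓ (lt_levelOf d t).le X

end TreePrefix

/-! ### The law of the truncated tree -/

section Law

/-- The probability of a root type. -/
noncomputable def rootProb (c : ℝ≥0) : VType → ℝ
  | .ordinary => c / (2 + c)
  | _ => 1 / (2 + c)

theorem rootLaw_real_singleton (c : ℝ≥0) (t : VType) :
    (rootLaw c).real {t} = rootProb c t := by
  have hdirac (a b : VType) : Measure.dirac a {b} = ({b} : Set VType).indicator 1 a :=
    Measure.dirac_apply' _ .of_discrete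
  have hcast : (2 + c : ENNReal).toReal = 2 + c := by
    rw [ENNReal.toReal_add (by simp) (by simp), ENNReal.toReal_ofNat, ENNReal.coe_toReal]
  cases t <;> simp only [rootLaw, rootProb, measureReal_def, hdirac, Measure.coe_add, Pi.add_apply,
    Measure.coe_nnreal_smul_apply] <;> simp [hcast]

instance (c : ℝ≥0) : IsProbabilityMeasure (rootLaw c) := by
  constructor
  have h : (1 / (2 + c) + c / (2 + c) + 1 / (2 + c) : ℝ≥0) = 1 := by
    have : (2 + c : ℝ≥0) ≠ 0 := by positivity
    field_simp
    ring
  simp only [rootLaw, Measure.coe_add, Measure.coe_nnreal_smul_apply, Pi.add_apply,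
    measure_univ, mul_one]
  exact_mod_cast h

instance (k : ℕ) (c : ℝ≥0) : IsProbabilityMeasure (treeLaw k c) := by
  unfold treeLaw
  infer_instance

variable {k d : ℕ}

/-- The event that the random tree has a given shape. -/
def prefixEvent (y : TreePrefix k d) : Set (VType × (List ℕ → ℕ)) :=
  (fun ω => prefixOf k d ω.1 ω.2) ⁻¹' {y}

theorem prefixEvent_eq_prod (y : TreePrefix k d) :
    prefixEvent y =
      {y.rootType} ×ˢ Set.pi (y.tables : Set (List ℕ)) fun u => {y.offspring u} := by
  ext ω
  simp only [prefixEvent, Set.mem_preimage, Set.mem_singleton_iff, TreePrefix.prefixOf_eq_iff,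
    Set.mem_prod, Set.mem_pi, Finset.mem_coe]

theorem measurableSet_prefixEvent (y : TreePrefix k d) : MeasurableSet (prefixEvent y) := by
  rw [prefixEvent_eq_prod]
  exact .prod .of_discrete (.pi (Finset.countable_toSet _) fun _ _ => .of_discrete)

theorem treeLaw_real_prefixEvent (c : ℝ≥0) (y : TreePrefix k d) :
    (treeLaw k c).real (prefixEvent y) = rootProb c y.rootType *
      ∏ u ∈ y.tables,
        (Real.exp (-(k * c)) * (k * c) ^ y.offspring u / (y.offspring u).factorial) := by
  rw [prefixEvent_eq_prod, treeLaw, measureReal_prod_prod, rootLaw_real_singleton, measureReal_def,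
    Measure.infinitePi_pi _ fun _ _ => .of_discrete, ENNReal.toReal_prod]
  congr 1
  refine Finset.prod_congr rfl fun u _ => ?_
  rw [← measureReal_def, poissonMeasure_real_singleton, NNReal.coe_mul, NNReal.coe_natCast]

theorem hasSum_indicator_measureReal_preimage {α ι : Type*} [MeasurableSpace α] [Countable ι]
    {μ : Measure α} [IsFiniteMeasure μ] {f : α → ι} (hf : ∀ i, MeasurableSet (f ⁻¹' {i}))
    (S : Set ι) :
    HasSum (S.indicator fun i => μ.real (f ⁻¹' {i})) (μ.real (f ⁻¹' S)) := by
  let _ : MeasurableSpace ι := ⊤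
  have hf' : Measurable f := measurable_to_countable' hf
  have hmap (A : Set ι) : μ (f ⁻¹' A) = μ.map f A := (Measure.map_apply hf' .of_discrete).symm
  have htsum := Measure.tsum_indicator_apply_singleton (μ.map f) S .of_discrete
  have hne : ∑' i, S.indicator (fun i => μ.map f {i}) i ≠ ⊤ := htsum ▸ measure_ne_top _ _
  convert! ENNReal.hasSum_toReal hne using 1
  · ext i
    by_cases hi : i ∈ S <;> simp [hi, measureReal_def, hmap]
  · rw [measureReal_def, hmap, ← htsum,
      ENNReal.tsum_toReal_eq (ENNReal.ne_top_of_tsum_ne_top hne)]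

theorem hasSum_indicator_prefixEvent (c : ℝ≥0) (S : Set (TreePrefix k d)) :
    HasSum (S.indicator fun y => (treeLaw k c).real (prefixEvent y))
      ((treeLaw k c).real {ω | prefixOf k d ω.1 ω.2 ∈ S}) :=
  hasSum_indicator_measureReal_preimage measurableSet_prefixEvent S

theorem hasSum_prefixEvent (c : ℝ≥0) :
    HasSum (fun y : TreePrefix k d => (treeLaw k c).real (prefixEvent y)) 1 := by
  simpa using hasSum_indicator_prefixEvent (k := k) (d := d) c Set.univ

theorem treeProb_ball_eq (ℓ : ℕ) (c : ℝ≥0) {P : RootedGraph → Prop}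
    (hP : RootedGraph.IsomInvariant P) :
    treeProb k ℓ c (fun R => P (R.ball d)) = (treeLaw k c).real {ω | prefixOf k d ω.1 ω.2 ∈
      {y : TreePrefix k d | P ((tree k ℓ y.rootType y.offspring).ball d)}} := by
  rw [treeProb]
  congr 1
  ext ω
  exact hP.iff (TreePrefix.isom_ball_prefixOf ℓ ω.1 ω.2)

end Law

/-! ### Convergence from lower bounds on the parts of a partition -/

section Convergence

variable {α ι : Type*} {l : Filter α} {p : ι → ℝ} {S : Set ι} {b : ℝ}

theorem eventually_lt_of_hasSum_indicator (hb : HasSum (S.indicator p) b) {P : α → ι → ℝ}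
    (hP : ∀ i, ∀ x < p i, ∀ᶠ n in l, x ≤ P n i) {a : α → ℝ}
    (ha : ∀ᶠ n in l, ∀ F : Finset ι, (F : Set ι) ⊆ S → ∑ i ∈ F, P n i ≤ a n)
    {x : ℝ} (hx : x < b) : ∀ᶠ n in l, x < a n := by
  classical
  obtain ⟨F, hF⟩ := (hb.eventually (lt_mem_nhds hx)).exists
  set F' := F.filter (· ∈ S)
  have hF' : ∑ i ∈ F, S.indicator p i = ∑ i ∈ F', p i := by
    rw [Finset.sum_filter]
    rfl
  rw [hF'] at hF
  have hF'S : (F' : Set ι) ⊆ S := fun i hi => (Finset.mem_filter.1 hi).2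
  let ε := (∑ i ∈ F', p i - x) / (F'.card + 1)
  have hε0 : 0 < ε := div_pos (by linarith) (by positivity)
  have hε : (F'.card + 1) * ε = ∑ i ∈ F', p i - x := mul_div_cancel₀ _ (by positivity)
  filter_upwards [ha, (Finset.eventually_all F').2 fun i _ => hP i (p i - ε) (by linarith)]
    with n hle hP'
  calc x < ∑ i ∈ F', (p i - ε) := by
        rw [Finset.sum_sub_distrib, Finset.sum_const, nsmul_eq_mul]
        linarith
    _ ≤ ∑ i ∈ F', P n i := Finset.sum_le_sum hP'
    _ ≤ a n := hle F' hF'S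

theorem tendsto_of_hasSum_one (hp : HasSum p 1) (hb : HasSum (S.indicator p) b) {P : α → ι → ℝ}
    (hP : ∀ i, ∀ x < p i, ∀ᶠ n in l, x ≤ P n i) {a : α → ℝ}
    (ha : ∀ᶠ n in l, ∀ F : Finset ι, (F : Set ι) ⊆ S → ∑ i ∈ F, P n i ≤ a n)
    (ha' : ∀ᶠ n in l, ∀ F : Finset ι, (F : Set ι) ⊆ Sᶜ → ∑ i ∈ F, P n i ≤ 1 - a n) :
    Tendsto a l (𝓝 b) := by
  have hb' : HasSum (Sᶜ.indicator p) (1 - b) := by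
    rw [Set.indicator_compl]
    exact hp.sub hb
  refine tendsto_order.2 ⟨fun x hx => eventually_lt_of_hasSum_indicator hb hP ha hx,
    fun x hx => ?_⟩
  filter_upwards [eventually_lt_of_hasSum_indicator hb' hP ha' (x := 1 - x) (by linarith)]
    with n hn
  linarith

theorem sum_card_fiber_div_le {Ω : Type*} [Finite Ω] {good R : Ω → Prop} {f : Ω → ι}
    {F : Finset ι} (hR : ∀ ω, good ω → f ω ∈ F → R ω) :
    ∑ i ∈ F, (Nat.card {ω // good ω ∧ f ω = i} : ℝ) / Nat.card Ω ≤
      (Nat.card {ω // R ω} : ℝ) / Nat.card Ω := by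
  classical
  have := Fintype.ofFinite Ω
  rw [← Finset.sum_div, ← Nat.cast_sum]
  refine div_le_div_of_nonneg_right (Nat.cast_le.2 ?_) (Nat.cast_nonneg _)
  simp only [Nat.card_eq_fintype_card, Fintype.card_subtype]
  rw [← Finset.card_biUnion]
  · refine Finset.card_le_card fun ω hω => ?_
    simp only [Finset.mem_biUnion, Finset.mem_filter_univ] at hω ⊢
    obtain ⟨i, hi, hgood, rfl⟩ := hω
    exact hR ω hgood hi
  · refine fun i _ j _ hij => Finset.disjoint_left.2 fun ω hi hj => hij ?_
    exact (Finset.mem_filter_univ _ |>.1 hi).2.symm.trans (Finset.mem_filter_univ _ |>.1 hj).2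

theorem card_not_div_eq_one_sub {Ω : Type*} [Finite Ω] [Nonempty Ω] (R : Ω → Prop) :
    (Nat.card {ω // ¬ R ω} : ℝ) / Nat.card Ω = 1 - (Nat.card {ω // R ω} : ℝ) / Nat.card Ω := by
  classical
  have hsum : Nat.card {ω // R ω} + Nat.card {ω // ¬ R ω} = Nat.card Ω := by
    rw [← Nat.card_sum, Nat.card_congr (Equiv.sumCompl R)]
  rw [← hsum, eq_sub_iff_add_eq, ← add_div, add_comm, ← Nat.cast_add, div_self]
  rw [hsum]
  exact Nat.cast_ne_zero.2 Nat.card_pos.ne'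

end Convergence

/-! ### Clusters: maximal sets of vertices connected through helper edges -/

section Clusters

/-- The number of children of type `A_C` of a vertex of type `B` whose parent has type `p`. -/
def nHelpers : Option VType → ℕ
  | some .helper => 1
  | _ => 2

theorem nHelpers_le_two (p : Option VType) : nHelpers p ≤ 2 := by
  rcases p with _ | _ | _ | _ <;> simp [nHelpers]

theorem nHelpers_of_ne {p : Option VType} (hp : p ≠ some .helper) : nHelpers p = 2 := by
  rcases p with _ | _ | _ | _ <;> simp_all [nHelpers]

section

variable {k x i : ℕ} {p : Option VType} {b : VType}

theorem getElem?_childTypes_eq_helper :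
    (childTypes k x p b)[i]? = some .helper ↔ b = .table ∧ i < nHelpers p := by
  rcases p with _ | _ | _ | _ <;> cases b <;>
    simp [childTypes, nHelpers, List.getElem?_replicate] <;> grind

theorem getElem?_childTypes_eq_ordinary :
    (childTypes k x p b)[i]? = some .ordinary ↔
      b = .table ∧ nHelpers p ≤ i ∧ i < nHelpers p + x := by
  rcases p with _ | _ | _ | _ <;> cases b <;>
    simp [childTypes, nHelpers, List.getElem?_replicate] <;> grind

theorem getElem?_childTypes_eq_table :
    (childTypes k x p b)[i]? = some .table ↔
      (b = .helper ∧ i < if p = none then 2 else 1) ∨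
        (b = .ordinary ∧ i < if p = none then k else k - 1) := by
  rcases p with _ | _ | _ | _ <;> cases b <;>
    simp [childTypes, List.getElem?_replicate] <;> grind

end

variable {k : ℕ} {t : VType} {X : List ℕ → ℕ} {i : ℕ} {u : List ℕ} {p : Option VType}

theorem parent_eq_none_iff {a : VType} (h : nodeInfo k t X u = some (p, a)) :
    p = none ↔ u = [] := by
  cases u with
  | nil => simp_all [nodeInfo]
  | cons i u =>
    obtain ⟨_, _, -, rfl, -⟩ := nodeInfo_cons_eq_some.1 h
    simp

theorem nodeInfo_cons_eq_helper :
    nodeInfo k t X (i :: u) = some (p, .helper) ↔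
      p = some .table ∧ ∃ q, nodeInfo k t X u = some (q, .table) ∧ i < nHelpers q := by
  simp only [nodeInfo_cons_eq_some, getElem?_childTypes_eq_helper]
  grind

theorem nodeInfo_cons_eq_ordinary :
    nodeInfo k t X (i :: u) = some (p, .ordinary) ↔
      p = some .table ∧ ∃ q, nodeInfo k t X u = some (q, .table) ∧ nHelpers q ≤ i ∧
        i < nHelpers q + X u := by
  simp only [nodeInfo_cons_eq_some, getElem?_childTypes_eq_ordinary]
  grind

theorem nodeInfo_cons_eq_table :
    nodeInfo k t X (i :: u) = some (p, .table) ↔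
      (p = some .helper ∧ ∃ q, nodeInfo k t X u = some (q, .helper) ∧
        i < if u = [] then 2 else 1) ∨
      (p = some .ordinary ∧ ∃ q, nodeInfo k t X u = some (q, .ordinary) ∧
        i < if u = [] then k else k - 1) := by
  have hroot {q : Option VType} {b : VType} (h : nodeInfo k t X u = some (q, b)) :=
    parent_eq_none_iff h
  simp only [nodeInfo_cons_eq_some, getElem?_childTypes_eq_table]
  grind

/-- The direction in which the `i`-th child of the head of a cluster, of type `a`, leaves it. -/
def turn : VType → ℕ → ℤ
  | .table, i => if i = 0 then 1 else -1
  | _, i => if i = 0 then -1 else 1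

theorem turn_eq_one_or (a : VType) (i : ℕ) : turn a i = 1 ∨ turn a i = -1 := by
  cases a <;> simp only [turn] <;> split_ifs <;> simp

theorem turn_injective_of_lt_two {a : VType} {i j : ℕ} (hi : i < 2) (hj : j < 2)
    (h : turn a i = turn a j) : i = j := by
  cases a <;> simp only [turn] at h <;> split_ifs at h <;> omega

/-- The coordinate of the head of a cluster, by the type of the head. -/
def headCoord : VType → ℤ
  | .helper => 1
  | _ => 0

/-- The place of a vertex in its cluster. A cluster is a path on which the types `A_C` and `B`
alternate. The vertices of type `B` have even and those of type `A_C` have odd coordinates. -/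
structure Frame where
  /-- The vertex of the cluster that is closest to the root. -/
  head : List ℕ
  /-- The coordinate on the path. -/
  coord : ℤ
  /-- The direction on the path from the parent, and `0` for the head. -/
  dir : ℤ

/-- The place of the child of a vertex with place `F`, where `δ` is the direction of the child in
case the vertex is a head. -/
def Frame.extend (F : Frame) (δ : ℤ) : Frame :=
  if F.dir = 0 then ⟨F.head, F.coord + δ, δ⟩ else ⟨F.head, F.coord + F.dir, F.dir⟩

variable (k t X) in
/-- The place of a vertex of type `A_C` or `B` in its cluster. Vertices of type `A_R` get a
meaningless value. -/
def frame : List ℕ → Frame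
  | [] => ⟨[], headCoord t, 0⟩
  | i :: u =>
    match nodeInfo k t X u with
    | some (_, .helper) => (frame u).extend (turn .helper i)
    | some (_, .table) => (frame u).extend (turn .table i)
    | _ => ⟨i :: u, 0, 0⟩

theorem frame_nil : frame k t X [] = ⟨[], headCoord t, 0⟩ :=
  rfl

theorem frame_cons_of_ordinary (h : nodeInfo k t X u = some (p, .ordinary)) :
    frame k t X (i :: u) = ⟨i :: u, 0, 0⟩ := by
  rw [frame, h]

theorem frame_cons {a : VType} (h : nodeInfo k t X u = some (p, a)) (ha : a ≠ .ordinary) :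
    frame k t X (i :: u) = (frame k t X u).extend (turn a i) := by
  rw [frame, h]
  cases a with
  | ordinary => exact absurd rfl ha
  | _ => rfl

theorem frame_cons_eq_or (i : ℕ) (u : List ℕ) : frame k t X (i :: u) = ⟨i :: u, 0, 0⟩ ∨
    ∃ a, frame k t X (i :: u) = (frame k t X u).extend (turn a i) := by
  rw [frame]
  split
  · exact .inr ⟨_, rfl⟩
  · exact .inr ⟨_, rfl⟩
  · exact .inl rfl

theorem Frame.head_extend (F : Frame) (δ : ℤ) : (F.extend δ).head = F.head := by
  rw [extend]
  split_ifs <;> rfl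

theorem Frame.dir_extend (F : Frame) (δ : ℤ) :
    (F.extend δ).dir = if F.dir = 0 then δ else F.dir := by
  rw [extend]
  split_ifs <;> rfl

theorem Frame.coord_extend (F : Frame) (δ : ℤ) :
    (F.extend δ).coord = F.coord + (F.extend δ).dir := by
  rw [extend]
  split_ifs <;> rfl

theorem dir_frame (u : List ℕ) : (frame k t X u).dir = 0 ∨ (frame k t X u).dir = 1 ∨
    (frame k t X u).dir = -1 := by
  induction u with
  | nil => exact .inl rfl
  | cons i u ih =>
    obtain h | ⟨a, h⟩ := frame_cons_eq_or (k := k) (t := t) (X := X) i u <;> rw [h]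
    · exact .inl rfl
    · rw [Frame.dir_extend]
      split_ifs
      exacts [.inr (turn_eq_one_or a i), ih]

theorem head_frame_suffix (u : List ℕ) : (frame k t X u).head <:+ u := by
  induction u with
  | nil => exact List.suffix_rfl
  | cons i u ih =>
    obtain h | ⟨a, h⟩ := frame_cons_eq_or (k := k) (t := t) (X := X) i u <;> rw [h]
    rw [Frame.head_extend]
    exact ih.trans (List.suffix_cons _ _)

theorem abs_coord_frame_le (u : List ℕ) : |(frame k t X u).coord| ≤ u.length + 1 := by
  induction u with
  | nil => cases t <;> simp [frame, headCoord]
  | cons i u ih =>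
    have hdir := dir_frame (k := k) (t := t) (X := X) (i :: u)
    obtain h | ⟨a, h⟩ := frame_cons_eq_or (k := k) (t := t) (X := X) i u <;> rw [h] at hdir ⊢
    · simp only [abs_zero]
      positivity
    · rw [Frame.coord_extend, List.length_cons]
      grind

theorem dir_frame_cons_ne_zero {a : VType} (h : nodeInfo k t X u = some (p, a))
    (ha : a ≠ .ordinary) : (frame k t X (i :: u)).dir ≠ 0 := by
  rw [frame_cons h ha, Frame.dir_extend]
  have := turn_eq_one_or a i
  split_ifs <;> omega

theorem frame_table_of_parent_ne_helper (h : nodeInfo k t X u = some (p, .table))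
    (hp : p ≠ some .helper) : frame k t X u = ⟨u, 0, 0⟩ := by
  cases u with
  | nil =>
    obtain ⟨-, rfl⟩ : none = p ∧ t = .table := by simpa [nodeInfo] using h
    rfl
  | cons i u =>
    rcases nodeInfo_cons_eq_table.1 h with ⟨rfl, -⟩ | ⟨-, q, hu, -⟩
    · exact absurd rfl hp
    · exact frame_cons_of_ordinary hu

theorem frame_cons_cons {j : ℕ} {q : Option VType} {a b : VType}
    (hu : nodeInfo k t X u = some (p, a)) (ha : a ≠ .ordinary)
    (hiu : nodeInfo k t X (i :: u) = some (q, b)) (hb : b ≠ .ordinary) :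
    (frame k t X (j :: i :: u)).head = (frame k t X u).head ∧
      (frame k t X (j :: i :: u)).coord =
        2 * (frame k t X (i :: u)).coord - (frame k t X u).coord := by
  have hdir := dir_frame_cons_ne_zero (i := i) hu ha
  rw [frame_cons hiu hb, Frame.coord_extend, Frame.dir_extend, if_neg hdir, Frame.head_extend,
    frame_cons hu ha, Frame.head_extend, Frame.coord_extend]
  exact ⟨rfl, by ring⟩

theorem coord_frame_emod_two {a : VType} (h : nodeInfo k t X u = some (p, a))
    (ha : a ≠ .ordinary) : (frame k t X u).coord % 2 = headCoord a := by
  have hstep (i : ℕ) {u q b} (hu : nodeInfo k t X u = some (q, b)) (hb : b ≠ .ordinary) :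
      ((frame k t X (i :: u)).coord - (frame k t X u).coord) % 2 = 1 := by
    have hne := dir_frame_cons_ne_zero (i := i) hu hb
    have hdir := dir_frame (k := k) (t := t) (X := X) (i :: u)
    rw [frame_cons hu hb] at hne hdir ⊢
    rw [Frame.coord_extend]
    omega
  induction u generalizing p a with
  | nil =>
    obtain ⟨-, rfl⟩ : none = p ∧ t = a := by simpa [nodeInfo] using h
    cases t <;> rfl
  | cons i u ih =>
    cases a with
    | ordinary => exact absurd rfl ha
    | helper =>
      obtain ⟨-, q, hu, -⟩ := nodeInfo_cons_eq_helper.1 h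
      have := hstep i hu (by simp)
      have := ih hu (by simp)
      simp only [headCoord] at this ⊢
      omega
    | table =>
      rcases nodeInfo_cons_eq_table.1 h with ⟨-, q, hu, -⟩ | ⟨-, q, hu, -⟩
      · have := hstep i hu (by simp)
        have := ih hu (by simp)
        simp only [headCoord] at this ⊢
        omega
      · rw [frame_cons_of_ordinary hu]
        rfl

theorem frame_eq_head_or_exists_parent {a : VType} (h : nodeInfo k t X u = some (p, a))
    (ha : a ≠ .ordinary) : frame k t X u = ⟨u, headCoord a, 0⟩ ∨
      ∃ i v q b, u = i :: v ∧ nodeInfo k t X v = some (q, b) ∧ b ≠ .ordinary := by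
  cases u with
  | nil =>
    obtain ⟨-, rfl⟩ : none = p ∧ t = a := by simpa [nodeInfo] using h
    exact .inl rfl
  | cons i u =>
    cases a with
    | ordinary => exact absurd rfl ha
    | helper =>
      obtain ⟨-, q, hu, -⟩ := nodeInfo_cons_eq_helper.1 h
      exact .inr ⟨i, u, q, _, rfl, hu, by simp⟩
    | table =>
      rcases nodeInfo_cons_eq_table.1 h with ⟨-, q, hu, -⟩ | ⟨-, q, hu, -⟩
      · exact .inr ⟨i, u, q, _, rfl, hu, by simp⟩
      · exact .inl (frame_cons_of_ordinary hu)

theorem index_lt_two_of_cluster {q : Option VType} {a b : VType}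
    (hu : nodeInfo k t X u = some (p, a)) (ha : a ≠ .ordinary)
    (hiu : nodeInfo k t X (i :: u) = some (q, b)) (hb : b ≠ .ordinary) :
    i < 2 ∧ ((frame k t X u).dir ≠ 0 → i = 0) := by
  cases b with
  | ordinary => exact absurd rfl hb
  | helper =>
    obtain ⟨-, r, hr, hi⟩ := nodeInfo_cons_eq_helper.1 hiu
    refine ⟨hi.trans_le (nHelpers_le_two r), fun hdir => ?_⟩
    have : r = some .helper := not_not.1 fun hr' =>
      hdir (by rw [frame_table_of_parent_ne_helper hr hr'])
    rw [this, nHelpers] at hi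
    omega
  | table =>
    rcases nodeInfo_cons_eq_table.1 hiu with ⟨-, r, -, hi⟩ | ⟨-, r, hr, -⟩
    · refine ⟨hi.trans_le (by split_ifs <;> simp), fun hdir => ?_⟩
      rw [if_neg (by rintro rfl; exact hdir rfl)] at hi
      omega
    · obtain ⟨-, rfl⟩ : p = r ∧ a = .ordinary := by simpa [hu] using hr
      exact absurd rfl ha

/-- A cluster consists of its head and of two paths, which leave the head towards its first two
children and continue through children with index `0`. -/
theorem frame_path {a : VType} (h : nodeInfo k t X u = some (p, a)) (ha : a ≠ .ordinary) :
    ∃ q b, nodeInfo k t X (frame k t X u).head = some (q, b) ∧ b ≠ .ordinary ∧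
      (frame k t X u = ⟨u, headCoord b, 0⟩ ∨
        ∃ i < 2, ∃ j : ℕ, u = List.replicate j 0 ++ i :: (frame k t X u).head ∧
          (frame k t X u).coord = headCoord b + (j + 1) * turn b i ∧
          (frame k t X u).dir = turn b i) := by
  induction u generalizing p a with
  | nil => exact ⟨p, a, h, ha, .inl (by simp_all [frame, nodeInfo])⟩
  | cons i v ih =>
    rcases frame_eq_head_or_exists_parent h ha with hhead | ⟨i', v', q, b, hcons, hv, hb⟩
    · exact ⟨p, a, by rw [hhead, h], ha, .inl hhead⟩
    obtain ⟨rfl, rfl⟩ := List.cons.inj hcons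
    obtain ⟨hi, hi0⟩ := index_lt_two_of_cluster hv hb h ha
    obtain ⟨q', b', hnode, hb', hpath⟩ := ih hv hb
    rw [frame_cons hv hb, Frame.coord_extend, Frame.dir_extend, Frame.head_extend]
    refine ⟨q', b', hnode, hb', .inr ?_⟩
    rcases hpath with hhead | ⟨i₀, hi₀, j, hu, hcoord, hdir⟩
    · rw [hhead] at hnode ⊢
      obtain ⟨rfl, rfl⟩ : q = q' ∧ b = b' := by simpa [hv] using hnode
      exact ⟨i, hi, 0, by simp⟩
    · have hne : (frame k t X v).dir ≠ 0 := by
        have := turn_eq_one_or b' i₀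
        omega
      refine ⟨i₀, hi₀, j + 1, ?_, ?_, ?_⟩
      · rw [hi0 hne, List.replicate_succ, List.cons_append, ← hu]
      · rw [if_neg hne, hcoord, hdir]
        push_cast
        ring
      · rw [if_neg hne, hdir]

theorem eq_of_frame_eq {v : List ℕ} {q : Option VType} {a b : VType}
    (hu : nodeInfo k t X u = some (p, a)) (ha : a ≠ .ordinary)
    (hv : nodeInfo k t X v = some (q, b)) (hb : b ≠ .ordinary)
    (hhead : (frame k t X u).head = (frame k t X v).head)
    (hcoord : (frame k t X u).coord = (frame k t X v).coord) : u = v := by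
  obtain ⟨p', a', hnode, -, hupath⟩ := frame_path hu ha
  obtain ⟨q', b', hnode', -, hvpath⟩ := frame_path hv hb
  obtain ⟨rfl, rfl⟩ : p' = q' ∧ a' = b' := by simpa [hhead, hnode'] using hnode.symm
  have hne (i j : ℕ) : (j + 1) * turn a' i ≠ 0 := by
    have := turn_eq_one_or a' i
    rcases this with h | h <;> rw [h] <;> omega
  rcases hupath with hu | ⟨i, hi, j, hu, hcu, -⟩ <;>
    rcases hvpath with hv | ⟨i', hi', j', hv, hcv, -⟩
  · simpa [hu, hv] using hhead
  · rw [← hcoord, hu] at hcv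
    exact absurd (by simpa using hcv) (hne i' j').symm
  · rw [hcoord, hv] at hcu
    exact absurd (by simpa using hcu) (hne i j).symm
  · have hturn : (j + 1) * turn a' i = (j' + 1) * turn a' i' := by linarith
    obtain ⟨rfl, rfl⟩ : i = i' ∧ j = j' := by
      have hinj := turn_injective_of_lt_two (a := a') hi hi'
      rcases turn_eq_one_or a' i with h | h <;> rcases turn_eq_one_or a' i' with h' | h' <;>
        rw [h, h'] at hturn hinj <;> omega
    rw [hu, hv, hhead]

end Clusters

/-! ### Placing a tree in the incidence graph -/

/-- The data that determine a map from a tree to the vertices of an incidence graph. Within a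
cluster, the position of the head determines all other positions. -/
structure Placement (n m k : ℕ) where
  /-- The positions on the cycle `ℤ_n` of the heads of the clusters. -/
  headPos : List ℕ → ZMod n
  /-- The ordinary edges for the vertices of type `A_R`. -/
  name : List ℕ → Fin m
  /-- The slots in which the vertices of type `A_R` contain their parents. -/
  slot : List ℕ → Fin (k + 1)

namespace Placement

section

variable {n m k : ℕ} (P : Placement n m k) (t : VType) (X : List ℕ → ℕ)

/-- The position on the cycle of a vertex of type `A_C` or `B`. -/
def pos (u : List ℕ) : ZMod n :=
  P.headPos (frame (k + 1) t X u).head + ((frame (k + 1) t X u).coord / 2 : ℤ)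

/-- The map from the tree to the vertices of the incidence graph. -/
def embed (u : List ℕ) : GVertex n m :=
  match nodeInfo (k + 1) t X u with
  | some (_, .helper) => .inl (.inl (P.pos t X u))
  | some (_, .ordinary) => .inl (.inr (P.name u))
  | _ => .inr (P.pos t X u)

/-- The image of the parent of a vertex. -/
def embedParent : List ℕ → Option (GVertex n m)
  | [] => none
  | _ :: u => some (P.embed t X u)

/-- The elements of the ordinary edge placed at a vertex of type `A_R`. -/
def row : List ℕ → Fin (k + 1) → ZMod n
  | [] => fun j => P.headPos [j.1]
  | i :: u => (P.slot (i :: u)).insertNth (α := fun _ => ZMod n) (P.pos t X u)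
      fun j => P.headPos (j.1 :: i :: u)

/-- The placement is injective up to depth `L` and numbers the children of type `A_R` of each
vertex in increasing order. -/
structure Admissible (L : ℕ) : Prop where
  injective : ∀ ⦃u v⦄, u.length ≤ L → v.length ≤ L → (nodeInfo (k + 1) t X u).isSome →
    (nodeInfo (k + 1) t X v).isSome → P.embed t X u = P.embed t X v → u = v
  increasing : ∀ ⦃i j u p q⦄, u.length < L → i < j →
    nodeInfo (k + 1) t X (i :: u) = some (p, .ordinary) →
    nodeInfo (k + 1) t X (j :: u) = some (q, .ordinary) → P.name (i :: u) < P.name (j :: u)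

/-- The ordinary edges used by the placement have the prescribed elements in the outcome `s`, and
the other ordinary edges avoid the positions of the vertices of type `B` of depth less than `L`. -/
structure Realizes (L : ℕ) (s : Fin m → Fin (k + 1) → ZMod n) : Prop where
  row_eq : ∀ ⦃u p⦄, u.length ≤ L → nodeInfo (k + 1) t X u = some (p, .ordinary) →
    s (P.name u) = P.row t X u
  avoid : ∀ ⦃e⦄,
    (∀ u p, u.length ≤ L → nodeInfo (k + 1) t X u = some (p, .ordinary) → P.name u ≠ e) →
    ∀ j, ∀ u ∈ tables (k + 1) L t X, s e j ≠ P.pos t X u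

end

end Placement

/-- All vertices of depth `L` have type `B`. -/
def EndsWithTables (k L : ℕ) (t : VType) (X : List ℕ → ℕ) : Prop :=
  ∀ ⦃u p a⦄, u.length = L → nodeInfo k t X u = some (p, a) → a = .table

theorem EndsWithTables.length_lt {k L : ℕ} {t : VType} {X : List ℕ → ℕ}
    (hL : EndsWithTables k L t X) {u : List ℕ} {p : Option VType} {a : VType}
    (hu : u.length ≤ L) (h : nodeInfo k t X u = some (p, a)) (ha : a ≠ .table) : u.length < L :=
  hu.lt_of_ne fun h' => ha (hL h' h)

namespace Placement

section Embedding

variable {n m k L : ℕ} {P : Placement n m k} {t : VType} {X : List ℕ → ℕ}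
  {s : Fin m → Fin (k + 1) → ZMod n} {i j : ℕ} {u : List ℕ} {p : Option VType}

theorem embed_helper (h : nodeInfo (k + 1) t X u = some (p, .helper)) :
    P.embed t X u = .inl (.inl (P.pos t X u)) := by
  rw [embed, h]

theorem embed_ordinary (h : nodeInfo (k + 1) t X u = some (p, .ordinary)) :
    P.embed t X u = .inl (.inr (P.name u)) := by
  rw [embed, h]

theorem embed_table (h : nodeInfo (k + 1) t X u = some (p, .table)) :
    P.embed t X u = .inr (P.pos t X u) := by
  rw [embed, h]

theorem gType_embed {a : VType} (h : nodeInfo (k + 1) t X u = some (p, a)) :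
    gType (P.embed t X u) = a := by
  cases a
  · rw [embed_helper h]; rfl
  · rw [embed_ordinary h]; rfl
  · rw [embed_table h]; rfl

theorem pos_cons_of_ordinary (h : nodeInfo (k + 1) t X u = some (p, .ordinary)) :
    P.pos t X (i :: u) = P.headPos (i :: u) := by
  simp [pos, frame_cons_of_ordinary h]

theorem pos_cons_cons_of_helper (h : nodeInfo (k + 1) t X (i :: u) = some (p, .helper)) :
    P.pos t X (j :: i :: u) = 2 * P.pos t X (i :: u) + 1 - P.pos t X u := by
  obtain ⟨-, q, hu, -⟩ := nodeInfo_cons_eq_helper.1 h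
  obtain ⟨hhead, hcoord⟩ := frame_cons_cons (j := j) hu (by simp) h (by simp)
  have hodd := coord_frame_emod_two h (by simp)
  have heven := coord_frame_emod_two hu (by simp)
  simp only [headCoord] at hodd heven
  have hhalf : (frame (k + 1) t X (j :: i :: u)).coord / 2 =
      2 * ((frame (k + 1) t X (i :: u)).coord / 2) + 1 - (frame (k + 1) t X u).coord / 2 := by
    omega
  rw [pos, pos, pos, hhead, hhalf, frame_cons hu (by simp), Frame.head_extend]
  push_cast
  ring

theorem pos_cons_cons_of_table (h : nodeInfo (k + 1) t X u = some (p, .helper))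
    {q : Option VType} (h' : nodeInfo (k + 1) t X (i :: u) = some (q, .table)) :
    P.pos t X (j :: i :: u) = 2 * P.pos t X (i :: u) - 1 - P.pos t X u := by
  obtain ⟨hhead, hcoord⟩ := frame_cons_cons (j := j) h (by simp) h' (by simp)
  have hodd := coord_frame_emod_two h (by simp)
  have heven := coord_frame_emod_two h' (by simp)
  simp only [headCoord] at hodd heven
  have hhalf : (frame (k + 1) t X (j :: i :: u)).coord / 2 =
      2 * ((frame (k + 1) t X (i :: u)).coord / 2) - 1 - (frame (k + 1) t X u).coord / 2 := by
    omega
  rw [pos, pos, pos, hhead, hhalf, frame_cons h (by simp), Frame.head_extend]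
  push_cast
  ring

theorem children_embed_helper (hu : nodeInfo (k + 1) t X u = some (p, .helper)) :
    children s (P.embedParent t X u) (P.embed t X u) =
      (List.range (if u = [] then 2 else 1)).map fun i => P.embed t X (i :: u) := by
  have hchild : ∀ i < (if u = [] then 2 else 1),
      P.embed t X (i :: u) = .inr (P.pos t X (i :: u)) := fun i hi =>
    embed_table (nodeInfo_cons_eq_table.2 (.inl ⟨rfl, p, hu, hi⟩))
  rw [embed_helper hu]
  cases u with
  | nil =>
    obtain ⟨-, rfl⟩ : none = p ∧ t = .helper := by simpa [nodeInfo] using hu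
    have h0 := hchild 0 (by simp)
    have h1 := hchild 1 (by simp)
    simp only [embedParent, children, if_true, List.range_succ, List.range_zero, List.nil_append,
      List.cons_append, List.map_cons, List.map_nil, h0, h1]
    simp [pos, frame_cons hu, frame_nil, Frame.extend, headCoord, turn]
  | cons i v =>
    obtain ⟨-, q, hv, -⟩ := nodeInfo_cons_eq_helper.1 hu
    simp only [embedParent, children, List.cons_ne_nil, if_false, List.range_one, List.map_cons,
      List.map_nil, hchild 0 (by simp), pos_cons_cons_of_helper hu, embed_table hv, coord]

theorem helperChildren_embed (hu : nodeInfo (k + 1) t X u = some (p, .table)) :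
    helperChildren (P.embedParent t X u) (P.pos t X u) =
      (List.range (nHelpers p)).map fun i => P.embed t X (i :: u) := by
  have hchild : ∀ i < nHelpers p,
      P.embed t X (i :: u) = .inl (.inl (P.pos t X (i :: u))) := fun i hi =>
    embed_helper (nodeInfo_cons_eq_helper.2 ⟨rfl, p, hu, hi⟩)
  by_cases hp : p = some .helper
  · subst hp
    cases u with
    | nil => simp [nodeInfo] at hu
    | cons i v =>
      obtain ⟨-, q, hv, -⟩ | ⟨⟨⟩, -⟩ := nodeInfo_cons_eq_table.1 hu
      simp only [nHelpers, List.range_one, List.map_cons, List.map_nil,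
        hchild 0 (by simp [nHelpers]), embedParent, embed_helper hv, helperChildren,
        pos_cons_cons_of_table hv hu]
  · have hparent : helperChildren (P.embedParent t X u) (P.pos t X u) =
        [.inl (.inl (P.pos t X u)), .inl (.inl (P.pos t X u - 1))] := by
      cases u with
      | nil => rfl
      | cons i v =>
        obtain ⟨rfl, -⟩ | ⟨-, q, hv, -⟩ := nodeInfo_cons_eq_table.1 hu
        · exact absurd rfl hp
        · rw [embedParent, embed_ordinary hv]
          rfl
    rw [nHelpers_of_ne hp] at hchild ⊢
    simp only [hparent, List.range_succ, List.range_zero, List.nil_append, List.cons_append,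
      List.map_cons, List.map_nil, hchild 0 (by simp), hchild 1 (by simp)]
    simp [pos, frame_cons hu, frame_table_of_parent_ne_helper hu hp, Frame.extend, turn,
      sub_eq_add_neg]

theorem Admissible.eq_of_pos_eq (hA : P.Admissible t X L) {v : List ℕ} {q : Option VType}
    (hul : u.length ≤ L) (hvl : v.length ≤ L) (hu : nodeInfo (k + 1) t X u = some (p, .table))
    (hv : nodeInfo (k + 1) t X v = some (q, .table)) (h : P.pos t X u = P.pos t X v) : u = v :=
  hA.injective hul hvl (by simp [hu]) (by simp [hv]) (by rw [embed_table hu, embed_table hv, h])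

theorem parentSlot_name (hL : EndsWithTables (k + 1) L t X) (hA : P.Admissible t X L)
    (hR : P.Realizes t X L s) (hul : (i :: u).length ≤ L)
    (hu : nodeInfo (k + 1) t X (i :: u) = some (p, .ordinary)) :
    parentSlot s (P.name (i :: u)) (P.pos t X u) = P.slot (i :: u) := by
  have hlt := hL.length_lt hul hu (by simp)
  have hrow := hR.row_eq hul hu
  obtain ⟨-, q, hv, -⟩ := nodeInfo_cons_eq_ordinary.1 hu
  by_contra hne
  obtain ⟨j, hj⟩ := Fin.exists_succAbove_eq hne
  have hslot := apply_parentSlot (s := s) (e := P.name (i :: u)) (b := P.pos t X u)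
    ⟨P.slot (i :: u), by rw [hrow, row, Fin.insertNth_apply_same]⟩
  rw [← hj, hrow, row, Fin.insertNth_apply_succAbove, ← pos_cons_of_ordinary hu] at hslot
  have hchild : nodeInfo (k + 1) t X (j.1 :: i :: u) = some (some .ordinary, .table) :=
    nodeInfo_cons_eq_table.2 (.inr ⟨rfl, p, hu, by simp⟩)
  have := congrArg List.length
    (hA.eq_of_pos_eq (u := j.1 :: i :: u) hlt ((Nat.le_succ _).trans hul) hchild hv hslot)
  simp only [List.length_cons] at this
  omega

theorem children_embed_ordinary (hL : EndsWithTables (k + 1) L t X) (hA : P.Admissible t X L)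
    (hR : P.Realizes t X L s) (hul : u.length ≤ L)
    (hu : nodeInfo (k + 1) t X u = some (p, .ordinary)) :
    children s (P.embedParent t X u) (P.embed t X u) =
      (List.range (if u = [] then k + 1 else k)).map fun i => P.embed t X (i :: u) := by
  have hchild : ∀ i < (if u = [] then k + 1 else k),
      .inr (P.headPos (i :: u)) = P.embed t X (i :: u) := fun i hi => by
    rw [embed_table (nodeInfo_cons_eq_table.2 (.inr ⟨rfl, p, hu, hi⟩)), pos_cons_of_ordinary hu]
  rw [embed_ordinary hu]
  cases u with
  | nil =>
    simp only [embedParent, children, hR.row_eq hul hu, row, if_true] at hchild ⊢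
    exact List.ext_getElem (by simp) fun i hi _ => by
      simpa [-List.ofFn_succ] using hchild i (by simpa using hi)
  | cons i v =>
    obtain ⟨-, q, hv, -⟩ := nodeInfo_cons_eq_ordinary.1 hu
    simp only [embedParent, children, embed_table hv, coord, parentSlot_name hL hA hR hul hu,
      hR.row_eq hul hu, row, Fin.insertNth_apply_succAbove, List.cons_ne_nil, if_false]
      at hchild ⊢
    exact List.ext_getElem (by simp) fun i hi _ => by
      simpa using hchild i (by simpa using hi)

theorem Admissible.embedParent_ne (hA : P.Admissible t X L) (hul : (i :: u).length ≤ L)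
    (hu : (nodeInfo (k + 1) t X (i :: u)).isSome) :
    P.embedParent t X u ≠ some (P.embed t X (i :: u)) := by
  cases u with
  | nil => simp [embedParent]
  | cons j v =>
    intro h
    have := congrArg List.length (hA.injective (by simp only [List.length_cons] at hul; omega)
      hul (isSome_nodeInfo_of_cons (isSome_nodeInfo_of_cons hu)) hu (Option.some.inj h))
    simp only [List.length_cons] at this
    omega

theorem exists_child_of_mem_row (hA : P.Admissible t X L) (hL : EndsWithTables (k + 1) L t X)
    {w : List ℕ} {q : Option VType} (hwl : w.length ≤ L)
    (hw : nodeInfo (k + 1) t X w = some (q, .ordinary)) (hul : u.length ≤ L)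
    (hu : nodeInfo (k + 1) t X u = some (p, .table)) (hchild : ∀ i, u ≠ i :: w)
    {j : Fin (k + 1)} (hj : P.row t X w j = P.pos t X u) : ∃ i, w = i :: u := by
  have hlt := hL.length_lt hwl hw (by simp)
  have hne : ∀ i < (if w = [] then k + 1 else k), P.headPos (i :: w) ≠ P.pos t X u := by
    intro i hi h
    rw [← pos_cons_of_ordinary hw] at h
    exact hchild i (hA.eq_of_pos_eq (u := i :: w) hlt hul
      (nodeInfo_cons_eq_table.2 (.inr ⟨rfl, q, hw, hi⟩)) hu h).symm
  cases w with
  | nil => exact absurd hj (hne j j.2)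
  | cons i v =>
    obtain ⟨-, r, hv, -⟩ := nodeInfo_cons_eq_ordinary.1 hw
    induction j using Fin.succAboveCases (P.slot (i :: v)) with
    | x =>
      rw [row, Fin.insertNth_apply_same] at hj
      exact ⟨i, by rw [hA.eq_of_pos_eq ((Nat.le_succ _).trans hwl) hul hv hu hj]⟩
    | p j =>
      rw [row, Fin.insertNth_apply_succAbove] at hj
      exact absurd hj (hne j j.2)

theorem ordinaryChildren_embed (hL : EndsWithTables (k + 1) L t X) (hA : P.Admissible t X L)
    (hR : P.Realizes t X L s) (hul : u.length < L)
    (hu : nodeInfo (k + 1) t X u = some (p, .table)) :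
    ordinaryChildren s (P.embedParent t X u) (P.pos t X u) =
      (Finset.range (X u)).image fun i => P.name ((nHelpers p + i) :: u) := by
  ext e
  simp only [ordinaryChildren, Finset.mem_filter, Finset.mem_univ, true_and, Finset.mem_image,
    Finset.mem_range]
  constructor
  · rintro ⟨⟨j, hj⟩, hparent⟩
    by_cases he : ∀ w q, w.length ≤ L → nodeInfo (k + 1) t X w = some (q, .ordinary) →
      P.name w ≠ e
    · exact absurd hj (hR.avoid he j u (mem_tables.2 ⟨hul, p, hu⟩))
    push Not at he
    obtain ⟨w, q, hwl, hw, rfl⟩ := he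
    rw [hR.row_eq hwl hw] at hj
    have hchild (i : ℕ) : u ≠ i :: w := by
      rintro rfl
      exact hparent (by rw [embedParent, embed_ordinary hw])
    obtain ⟨i, rfl⟩ := exists_child_of_mem_row hA hL hwl hw hul.le hu hchild hj
    obtain ⟨-, r, hr, hi⟩ := nodeInfo_cons_eq_ordinary.1 hw
    obtain rfl : p = r := by simpa [hu] using hr
    exact ⟨i - nHelpers p, by omega, by rw [Nat.add_sub_cancel' hi.1]⟩
  · rintro ⟨i, hi, rfl⟩
    have hnode : nodeInfo (k + 1) t X ((nHelpers p + i) :: u) = some (some .table, .ordinary) :=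
      nodeInfo_cons_eq_ordinary.2 ⟨rfl, p, hu, by omega, by omega⟩
    refine ⟨⟨P.slot ((nHelpers p + i) :: u), ?_⟩, ?_⟩
    · rw [hR.row_eq (u := _ :: u) hul hnode, row, Fin.insertNth_apply_same]
    · rw [← embed_ordinary hnode]
      exact hA.embedParent_ne hul (by simp [hnode])

theorem sort_ordinaryChildren_embed (hL : EndsWithTables (k + 1) L t X)
    (hA : P.Admissible t X L) (hR : P.Realizes t X L s) (hul : u.length < L)
    (hu : nodeInfo (k + 1) t X u = some (p, .table)) :
    (ordinaryChildren s (P.embedParent t X u) (P.pos t X u)).sort (· ≤ ·) =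
      (List.range (X u)).map fun i => P.name ((nHelpers p + i) :: u) := by
  have hnode : ∀ i < X u,
      nodeInfo (k + 1) t X ((nHelpers p + i) :: u) = some (some .table, .ordinary) := fun i hi =>
    nodeInfo_cons_eq_ordinary.2 ⟨rfl, p, hu, by omega, by omega⟩
  have hlt : ((List.range (X u)).map fun i => P.name ((nHelpers p + i) :: u)).Pairwise
      (· < ·) := by
    rw [List.pairwise_map]
    refine List.pairwise_lt_range.imp_of_mem fun {i j} hi hj hij => ?_
    rw [List.mem_range] at hi hj
    exact hA.increasing hul (by omega) (hnode i hi) (hnode j hj)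
  have hset : ((Finset.range (X u)).image fun i => P.name ((nHelpers p + i) :: u)) =
      ((List.range (X u)).map fun i => P.name ((nHelpers p + i) :: u)).toFinset := by
    ext
    simp
  rw [ordinaryChildren_embed hL hA hR hul hu, hset, List.toFinset_sort _ hlt.nodup]
  exact hlt.imp le_of_lt

theorem children_embed_table (hL : EndsWithTables (k + 1) L t X) (hA : P.Admissible t X L)
    (hR : P.Realizes t X L s) (hul : u.length < L)
    (hu : nodeInfo (k + 1) t X u = some (p, .table)) :
    children s (P.embedParent t X u) (P.embed t X u) =
      (List.range (nHelpers p + X u)).map fun i => P.embed t X (i :: u) := by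
  rw [embed_table hu, children, helperChildren_embed hu,
    sort_ordinaryChildren_embed hL hA hR hul hu, List.range_add, List.map_append, List.map_map,
    List.map_map]
  congr 1
  refine List.map_congr_left fun i hi => (embed_ordinary (p := some .table) ?_).symm
  exact nodeInfo_cons_eq_ordinary.2 ⟨rfl, p, hu, by omega, by simpa using hi⟩

theorem walk_embed (hL : EndsWithTables (k + 1) L t X) (hA : P.Admissible t X L)
    (hR : P.Realizes t X L s) (hul : u.length ≤ L) (hu : (nodeInfo (k + 1) t X u).isSome) :
    walk s (P.embed t X []) u = some (P.embedParent t X u, P.embed t X u) := by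
  induction u with
  | nil => rfl
  | cons i u ih =>
    have hlt : u.length < L := hul
    refine walk_cons_eq_some.2 ⟨_, _, ih hlt.le (isSome_nodeInfo_of_cons hu), rfl, ?_⟩
    obtain ⟨⟨p, a⟩, hpa⟩ := Option.isSome_iff_exists.1 hu
    cases a with
    | helper =>
      obtain ⟨-, q, hq, hi⟩ := nodeInfo_cons_eq_helper.1 hpa
      simp [children_embed_table hL hA hR hlt hq, show i < nHelpers q + X u by omega]
    | ordinary =>
      obtain ⟨-, q, hq, -, hi⟩ := nodeInfo_cons_eq_ordinary.1 hpa
      simp [children_embed_table hL hA hR hlt hq, hi]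
    | table =>
      rcases nodeInfo_cons_eq_table.1 hpa with ⟨-, q, hq, hi⟩ | ⟨-, q, hq, hi⟩
      · simp [children_embed_helper hq, hi]
      · rw [Nat.add_sub_cancel] at hi
        simp [children_embed_ordinary hL hA hR hlt.le hq, hi]

theorem offspring_embed (hL : EndsWithTables (k + 1) L t X) (hA : P.Admissible t X L)
    (hR : P.Realizes t X L s) (hu : u ∈ tables (k + 1) L t X) :
    offspring s (P.embed t X []) u = X u := by
  obtain ⟨hul, p, hp⟩ := mem_tables.1 hu
  have hsort := sort_ordinaryChildren_embed hL hA hR hul hp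
  rw [offspring, walk_embed hL hA hR hul.le (by simp [hp]), embed_table hp]
  simpa [ordinaryCount] using congrArg List.length hsort

theorem walkInjective_embed (hL : EndsWithTables (k + 1) L t X) (hA : P.Admissible t X L)
    (hR : P.Realizes t X L s) : WalkInjective s (P.embed t X []) L := by
  have hnode {u q} (hul : u.length ≤ L) (hu : walk s (P.embed t X []) u = some q) :
      (nodeInfo (k + 1) t X u).isSome := by
    have h := nodeInfo_offspring (s := s) (P.embed t X []) u
    rw [gType_embed (p := none) rfl, hu,
      nodeInfo_congr (fun v hv => offspring_embed hL hA hR hv) hul] at h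
    rw [h]
    rfl
  intro u v p q x hul hvl hu hv
  have hu' := hnode hul hu
  have hv' := hnode hvl hv
  rw [walk_embed hL hA hR hul hu'] at hu
  rw [walk_embed hL hA hR hvl hv'] at hv
  simp only [Option.some.injEq, Prod.mk.injEq] at hu hv
  exact hA.injective hul hvl hu' hv' (hu.2.trans hv.2.symm)

end Embedding

end Placement

/-! ### Counting separated families and increasing maps -/

section Counting

theorem card_sub_le_card_forall_not {α ι : Type*} [Fintype α] [Fintype ι] {r : α → α → Prop}
    {B : ℕ} (hB : ∀ b, Nat.card {a // r a b} ≤ B) (f : ι → α) :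
    Fintype.card α - Fintype.card ι * B ≤ Nat.card {a // ∀ j, ¬ r a (f j)} := by
  classical
  have hcover : Finset.univ ⊆ (Finset.univ.filter fun a => ∀ j, ¬ r a (f j)) ∪
      Finset.univ.biUnion fun j => Finset.univ.filter fun a => r a (f j) := by
    intro a _
    simp only [Finset.mem_union, Finset.mem_filter, Finset.mem_univ, true_and, Finset.mem_biUnion]
    by_contra! h
    obtain ⟨⟨j, hj⟩, h⟩ := h
    exact h j hj
  have hbad : (Finset.univ.biUnion fun j => Finset.univ.filter fun a => r a (f j)).card ≤
      Fintype.card ι * B :=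
    Finset.card_biUnion_le_card_mul _ _ B fun j _ => by
      simpa only [Nat.card_eq_fintype_card, Fintype.card_subtype] using hB (f j)
  have hcard := (Finset.card_le_card hcover).trans (Finset.card_union_le _ _)
  rw [Finset.card_univ] at hcard
  rw [Nat.card_eq_fintype_card, Fintype.card_subtype]
  omega

theorem card_sub_pow_le_card_separated_fin {α : Type*} [Fintype α] {r : α → α → Prop}
    [Std.Symm r] {B : ℕ} (hB : ∀ b, Nat.card {a // r a b} ≤ B) (K : ℕ) :
    (Fintype.card α - K * B) ^ K ≤
      Nat.card {f : Fin K → α // Pairwise fun i j => ¬ r (f i) (f j)} := by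
  classical
  induction K with
  | zero => simp [Subsingleton.pairwise]
  | succ K ih =>
    have hcons {f : Fin K → α} (hf : Pairwise fun i j => ¬ r (f i) (f j)) {a : α}
        (ha : ∀ j, ¬ r a (f j)) :
        Pairwise fun i j =>
          ¬ r (Fin.cons (α := fun _ => α) a f i) (Fin.cons (α := fun _ => α) a f j) := by
      intro i j hij
      induction i using Fin.cases <;> induction j using Fin.cases
      · exact absurd rfl hij
      · exact ha _
      · exact fun h => ha _ (symm h)
      · exact hf fun h => hij (congrArg Fin.succ h)
    calc (Fintype.card α - (K + 1) * B) ^ (K + 1)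
        ≤ (Fintype.card α - K * B) ^ K * (Fintype.card α - K * B) := by
          rw [← pow_succ]
          gcongr
          exact K.le_succ
      _ ≤ Nat.card {f : Fin K → α // Pairwise fun i j => ¬ r (f i) (f j)} *
            (Fintype.card α - K * B) := Nat.mul_le_mul_right _ ih
      _ ≤ ∑ f : {f : Fin K → α // Pairwise fun i j => ¬ r (f i) (f j)},
            Nat.card {a // ∀ j, ¬ r a (f.1 j)} := by
          rw [Nat.card_eq_fintype_card, ← Finset.card_univ, ← smul_eq_mul]
          refine Finset.card_nsmul_le_sum _ _ _ fun f _ => ?_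
          simpa only [Fintype.card_fin] using card_sub_le_card_forall_not hB f.1
      _ = Nat.card (Σ f : {f : Fin K → α // Pairwise fun i j => ¬ r (f i) (f j)},
            {a // ∀ j, ¬ r a (f.1 j)}) := Nat.card_sigma.symm
      _ ≤ _ := by
          refine Nat.card_le_card_of_injective
            (fun x => ⟨Fin.cons x.2.1 x.1.1, hcons x.1.2 x.2.2⟩) ?_
          rintro ⟨⟨f, hf⟩, a, ha⟩ ⟨⟨g, hg⟩, b, hb⟩ h
          obtain ⟨rfl, rfl⟩ := Fin.cons_injective2 (α := fun _ => α) (congrArg Subtype.val h)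
          rfl

theorem card_sub_pow_le_card_separated {α ι : Type*} [Fintype α] [Fintype ι] {r : α → α → Prop}
    [Std.Symm r] {B : ℕ} (hB : ∀ b, Nat.card {a // r a b} ≤ B) :
    (Fintype.card α - Fintype.card ι * B) ^ Fintype.card ι ≤
      Nat.card {f : ι → α // Pairwise fun i j => ¬ r (f i) (f j)} := by
  let e := Fintype.equivFin ι
  refine (card_sub_pow_le_card_separated_fin hB _).trans (Nat.card_congr ?_).le
  exact (e.arrowCongr (Equiv.refl α)).symm.subtypeEquiv fun f =>
    (e.bijective.pairwise_comp_iff (r := fun i j => ¬ r (f i) (f j))).symm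

theorem exists_perm_strictMonoOn_fibers {ι κ M : Type*} [Finite ι] [LinearOrder ι]
    [LinearOrder M] (π : ι → κ) {f : ι → M} (hf : Function.Injective f) :
    ∃ σ : Equiv.Perm ι, π ∘ σ = π ∧ ∀ ⦃i j⦄, π i = π j → i < j → f (σ i) < f (σ j) := by
  classical
  cases nonempty_fintype ι
  have hfiber (x : κ) : ∃ σ : Equiv.Perm {i // π i = x}, StrictMono fun i => f (σ i) := by
    let o := Fintype.orderIsoFinOfCardEq {i // π i = x} rfl
    let g : Fin (Fintype.card {i // π i = x}) → M := fun i => f (o i)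
    have hg : StrictMono (g ∘ Tuple.sort g) :=
      (Tuple.monotone_sort g).strictMono_of_injective
        ((hf.comp (Subtype.val_injective.comp o.injective)).comp (Tuple.sort g).injective)
    exact ⟨(o.symm.toEquiv.trans (Tuple.sort g)).trans o.toEquiv, hg.comp o.symm.strictMono⟩
  choose τ hτ using hfiber
  have hσ : ∀ (x : κ) (i : {i // π i = x}), (Equiv.sigmaFiberEquiv π).permCongr
      (Equiv.Perm.sigmaCongrRight τ) i = τ x i := by
    rintro _ ⟨i, rfl⟩
    rfl
  refine ⟨(Equiv.sigmaFiberEquiv π).permCongr (Equiv.Perm.sigmaCongrRight τ), ?_, ?_⟩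
  · ext i
    exact (τ (π i) ⟨i, rfl⟩).2
  · intro i j hij hlt
    rw [hσ (π j) ⟨i, hij⟩, hσ (π j) ⟨j, rfl⟩]
    exact hτ (π j) hlt

theorem descFactorial_le_card_increasing {ι κ M : Type*} [Fintype ι] [LinearOrder ι]
    [DecidableEq κ] [Fintype M] [LinearOrder M] (π : ι → κ) :
    (Fintype.card M).descFactorial (Fintype.card ι) ≤
      Nat.card {f : ι → M // Function.Injective f ∧ ∀ ⦃i j⦄, π i = π j → i < j → f i < f j} *
      ∏ x ∈ Finset.univ.image π, (Nat.card {i // π i = x}).factorial := by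
  classical
  have hprod : ∏ x ∈ Finset.univ.image π, (Nat.card {i // π i = x}).factorial =
      Nat.card {σ : Equiv.Perm ι // π ∘ σ = π} := by
    simp only [Nat.card_eq_fintype_card, DomMulAct.stabilizer_card']
  choose σ hσ hmono using fun f : ι ↪ M => exists_perm_strictMonoOn_fibers π f.injective
  rw [hprod, ← Fintype.card_embedding_eq, ← Nat.card_eq_fintype_card, ← Nat.card_prod]
  refine Nat.card_le_card_of_injective (fun f =>
    (⟨f ∘ σ f, f.injective.comp (σ f).injective, hmono f⟩, ⟨σ f, hσ f⟩)) fun f g h => ?_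
  simp only [Prod.mk.injEq, Subtype.mk.injEq] at h
  rw [← h.2] at h
  exact DFunLike.coe_injective ((σ f).surjective.injective_comp_right h.1)

end Counting

/-! ### Counting ordinary edges and clusters of a tree -/

section TreeCounts

variable {k L : ℕ} {t : VType} {X : List ℕ → ℕ}

open Classical in
/-- The vertices of type `A_R` of depth at most `L`. -/
noncomputable def ordinaries (k L : ℕ) (t : VType) (X : List ℕ → ℕ) : Finset (List ℕ) :=
  (finite_nodes k L t X).toFinset.filter fun u => ∃ p, nodeInfo k t X u = some (p, .ordinary)

open Classical in
/-- The heads of the clusters, of depth at most `L`. -/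
noncomputable def heads (k L : ℕ) (t : VType) (X : List ℕ → ℕ) : Finset (List ℕ) :=
  (finite_nodes k L t X).toFinset.filter fun u =>
    (frame k t X u).head = u ∧ ∃ p a, nodeInfo k t X u = some (p, a) ∧ a ≠ .ordinary

theorem mem_ordinaries {u : List ℕ} : u ∈ ordinaries k L t X ↔
    u.length ≤ L ∧ ∃ p, nodeInfo k t X u = some (p, .ordinary) := by
  simp only [ordinaries, Finset.mem_filter, Set.Finite.mem_toFinset, Set.mem_ofPred_eq]
  exact ⟨fun h => ⟨h.1.1, h.2⟩, fun ⟨hu, p, hp⟩ => ⟨⟨hu, by simp [hp]⟩, p, hp⟩⟩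

theorem mem_heads {u : List ℕ} : u ∈ heads k L t X ↔ u.length ≤ L ∧
    (frame k t X u).head = u ∧ ∃ p a, nodeInfo k t X u = some (p, a) ∧ a ≠ .ordinary := by
  simp only [heads, Finset.mem_filter, Set.Finite.mem_toFinset, Set.mem_ofPred_eq]
  exact ⟨fun h => ⟨h.1.1, h.2⟩,
    fun ⟨hu, hf, p, a, hp, ha⟩ => ⟨⟨hu, by simp [hp]⟩, hf, p, a, hp, ha⟩⟩

theorem nil_mem_ordinaries : [] ∈ ordinaries k L t X ↔ t = .ordinary := by
  simp [mem_ordinaries, nodeInfo]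

theorem nil_mem_heads : [] ∈ heads k L t X ↔ t ≠ .ordinary := by
  simp [mem_heads, nodeInfo, frame_nil]

theorem exists_cons_mem_ordinaries_iff {u : List ℕ} (hu : u ∈ tables k L t X) :
    ∃ h, ∀ i, i :: u ∈ ordinaries k L t X ↔ h ≤ i ∧ i < h + X u := by
  obtain ⟨hul, p, hp⟩ := mem_tables.1 hu
  refine ⟨nHelpers p, fun i => ?_⟩
  rw [mem_ordinaries]
  constructor
  · rintro ⟨-, q, hq⟩
    obtain ⟨-, r, hr, hi⟩ := nodeInfo_cons_eq_ordinary.1 hq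
    obtain rfl : p = r := by simpa [hp] using hr
    exact hi
  · exact fun hi => ⟨hul, _, nodeInfo_cons_eq_ordinary.2 ⟨rfl, p, hp, hi⟩⟩

theorem tail_mem_tables {u : List ℕ} (h : u ∈ ordinaries k L t X) (hu : u ≠ []) :
    u.tail ∈ tables k L t X := by
  obtain ⟨i, v, rfl⟩ := List.exists_cons_of_ne_nil hu
  obtain ⟨hl, p, hp⟩ := mem_ordinaries.1 h
  obtain ⟨-, q, hv, -⟩ := nodeInfo_cons_eq_ordinary.1 hp
  exact mem_tables.2 ⟨hl, q, hv⟩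

theorem cons_mem_heads (hL : EndsWithTables k L t X) {i : ℕ} {u : List ℕ} :
    i :: u ∈ heads k L t X ↔ u ∈ ordinaries k L t X ∧ i < if u = [] then k else k - 1 := by
  rw [mem_heads, mem_ordinaries]
  constructor
  · rintro ⟨hl, hhead, p, a, hp, ha⟩
    have hparent {q b} (hu : nodeInfo k t X u = some (q, b)) : b = .ordinary := by
      by_contra hb
      rw [frame_cons hu hb, Frame.head_extend] at hhead
      have := (hhead ▸ head_frame_suffix u).length_le
      simp at this
    cases a with
    | ordinary => exact absurd rfl ha
    | helper =>
      obtain ⟨-, q, hq, -⟩ := nodeInfo_cons_eq_helper.1 hp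
      exact absurd (hparent hq) (by simp)
    | table =>
      obtain ⟨-, q, hq, -⟩ | ⟨-, q, hq, hi⟩ := nodeInfo_cons_eq_table.1 hp
      · exact absurd (hparent hq) (by simp)
      · exact ⟨⟨(Nat.le_succ _).trans hl, q, hq⟩, hi⟩
  · rintro ⟨⟨hul, q, hq⟩, hi⟩
    exact ⟨hL.length_lt hul hq (by simp), by rw [frame_cons_of_ordinary hq], _, _,
      nodeInfo_cons_eq_table.2 (.inr ⟨rfl, q, hq, hi⟩), by simp⟩

theorem card_filter_tail {S : Finset (List ℕ)} {u : List ℕ} {a b : ℕ}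
    (h : ∀ i, i :: u ∈ S ↔ a ≤ i ∧ i < a + b) :
    ((S.erase []).filter fun v => v.tail = u).card = b := by
  have himage : (S.erase []).filter (fun v => v.tail = u) =
      (Finset.Ico a (a + b)).image (· :: u) := by
    ext v
    cases v with
    | nil => simp
    | cons i v =>
      simp only [Finset.mem_filter, Finset.mem_erase, Finset.mem_image, Finset.mem_Ico, ← h,
        List.cons.injEq, List.tail_cons]
      aesop
  rw [himage, Finset.card_image_of_injective _ fun _ _ h => (List.cons.inj h).1, Nat.card_Ico,
    Nat.add_sub_cancel_left]

theorem card_erase_nil_eq_sum {S T : Finset (List ℕ)} {g : List ℕ → ℕ}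
    (hST : ∀ u ∈ S, u ≠ [] → u.tail ∈ T)
    (h : ∀ u ∈ T, ∃ a, ∀ i, i :: u ∈ S ↔ a ≤ i ∧ i < a + g u) :
    (S.erase []).card = ∑ u ∈ T, g u := by
  rw [Finset.card_eq_sum_card_fiberwise (f := List.tail) (t := T)
    fun u hu => hST u (Finset.mem_of_mem_erase hu) (Finset.ne_of_mem_erase hu)]
  exact Finset.sum_congr rfl fun u hu => card_filter_tail (h u hu).choose_spec

theorem card_ordinaries_erase_nil :
    ((ordinaries k L t X).erase []).card = ∑ v ∈ tables k L t X, X v :=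
  card_erase_nil_eq_sum (fun _ => tail_mem_tables) fun _ => exists_cons_mem_ordinaries_iff

theorem card_heads (hL : EndsWithTables (k + 1) L t X) :
    (heads (k + 1) L t X).card = 1 + k * (ordinaries (k + 1) L t X).card := by
  have herase : ((heads (k + 1) L t X).erase []).card =
      k * (ordinaries (k + 1) L t X).card + if [] ∈ ordinaries (k + 1) L t X then 1 else 0 := by
    rw [card_erase_nil_eq_sum (T := ordinaries (k + 1) L t X)
      (g := fun u => k + if u = [] then 1 else 0)]
    · simp only [Finset.sum_add_distrib, Finset.sum_const, smul_eq_mul, Finset.sum_ite_eq',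
        mul_comm]
    · intro u hu hne
      obtain ⟨i, u, rfl⟩ := List.exists_cons_of_ne_nil hne
      exact ((cons_mem_heads hL).1 hu).1
    · refine fun u hu => ⟨0, fun i => ?_⟩
      rw [cons_mem_heads hL, and_iff_right hu]
      split_ifs <;> simp
  by_cases ht : t = .ordinary
  · rw [Finset.erase_eq_of_notMem (by simp [nil_mem_heads, ht])] at herase
    rw [herase, if_pos (nil_mem_ordinaries.2 ht), add_comm]
  · rw [Finset.card_erase_of_mem (nil_mem_heads.2 ht),
      if_neg (mt nil_mem_ordinaries.1 ht)] at herase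
    have : 0 < (heads (k + 1) L t X).card := Finset.card_pos.2 ⟨[], nil_mem_heads.2 ht⟩
    omega

theorem card_siblings_factorial (v : List ℕ) :
    (Nat.card {u : ordinaries k L t X // u.1.tail = v}).factorial =
      if v ∈ tables k L t X then (X v).factorial else 1 := by
  have hcard : Nat.card {u : ordinaries k L t X // u.1.tail = v} =
      ((ordinaries k L t X).filter fun u => u.tail = v).card :=
    (Nat.card_congr (Equiv.subtypeSubtypeEquivSubtypeInter _ _)).trans
      (Nat.subtype_card ((ordinaries k L t X).filter fun u => u.tail = v) fun _ =>
        Finset.mem_filter)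
  rw [hcard]
  split_ifs with hv
  · have hnil : ([] : List ℕ) ∉ (ordinaries k L t X).filter fun u => u.tail = v := by
      intro h
      obtain ⟨hnil, rfl⟩ := Finset.mem_filter.1 h
      obtain ⟨-, p, hp⟩ := mem_ordinaries.1 hnil
      obtain ⟨-, q, hq⟩ := mem_tables.1 hv
      simp [hp] at hq
    rw [← Finset.erase_eq_of_notMem hnil, ← Finset.filter_erase,
      card_filter_tail (exists_cons_mem_ordinaries_iff hv).choose_spec]
  · refine Nat.factorial_eq_one.2 ?_
    refine Finset.card_le_one_iff_subset_singleton.2 ⟨[], fun u hu => ?_⟩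
    obtain ⟨hord, rfl⟩ := Finset.mem_filter.1 hu
    by_contra hne
    exact hv (tail_mem_tables hord (by simpa using hne))

theorem prod_card_siblings_factorial_le :
    ∏ v ∈ Finset.univ.image fun u : ordinaries k L t X => u.1.tail,
      (Nat.card {u : ordinaries k L t X // u.1.tail = v}).factorial ≤
      ∏ v ∈ tables k L t X, (X v).factorial := by
  rw [Finset.prod_congr rfl fun v _ => card_siblings_factorial v, ← Finset.prod_filter]
  refine Finset.prod_le_prod_of_subset_of_one_le' ?_ fun v _ _ => Nat.factorial_pos _
  exact fun v hv => (Finset.mem_filter.1 hv).2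

end TreeCounts

/-! ### Counting placements -/

section Placements

variable {n m k L : ℕ} {t : VType} {X : List ℕ → ℕ}

/-- Two elements of `ℤ_n` are close if clusters of depth at most `L` with these positions of their
heads can intersect. -/
def Close (L : ℕ) (a b : ZMod n) : Prop := ∃ δ : ℤ, |δ| ≤ 2 * L + 2 ∧ a = b + δ

instance : Std.Symm (Close (n := n) L) where
  symm := by
    rintro _ b ⟨δ, hδ, rfl⟩
    exact ⟨-δ, by rwa [abs_neg], by simp⟩

theorem card_close_le (b : ZMod n) : Nat.card {a // Close L a b} ≤ 4 * L + 5 := by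
  have hsurj : Function.Surjective fun δ : Finset.Icc (-(2 * L + 2 : ℤ)) (2 * L + 2) =>
      (⟨b + (δ : ℤ), δ, abs_le.2 (Finset.mem_Icc.1 δ.2), rfl⟩ : {a // Close L a b}) := by
    rintro ⟨_, δ, hδ, rfl⟩
    exact ⟨⟨δ, Finset.mem_Icc.2 (abs_le.1 hδ)⟩, rfl⟩
  refine (Nat.card_le_card_of_surjective _ hsurj).trans ?_
  rw [Nat.card_eq_fintype_card, Fintype.card_coe, Int.card_Icc]
  omega

theorem head_frame_head (u : List ℕ) :
    (frame k t X (frame k t X u).head).head = (frame k t X u).head := by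
  induction u with
  | nil => rfl
  | cons i u ih =>
    obtain h | ⟨a, h⟩ := frame_cons_eq_or (k := k) (t := t) (X := X) i u
    · rw [h, h]
    · rw [h, Frame.head_extend, ih]

theorem frame_eq_of_head_eq_self {u : List ℕ} {p : Option VType} {a : VType}
    (h : nodeInfo k t X u = some (p, a)) (ha : a ≠ .ordinary) (hhead : (frame k t X u).head = u) :
    frame k t X u = ⟨u, headCoord a, 0⟩ := by
  obtain ⟨q, b, hb, -, hframe | ⟨i, -, j, hu, -⟩⟩ := frame_path h ha
  · rw [hhead, h] at hb
    obtain ⟨-, rfl⟩ : p = q ∧ a = b := by simpa using hb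
    exact hframe
  · have := congrArg List.length hu
    rw [hhead] at this
    simp at this
    omega

theorem head_frame_mem_heads {u : List ℕ} {p : Option VType} {a : VType}
    (hu : nodeInfo k t X u = some (p, a)) (ha : a ≠ .ordinary) (hul : u.length ≤ L) :
    (frame k t X u).head ∈ heads k L t X := by
  obtain ⟨q, b, hb, hne, -⟩ := frame_path hu ha
  exact mem_heads.2 ⟨(head_frame_suffix u).length_le.trans hul, head_frame_head u, q, b, hb, hne⟩

namespace Placement

variable {P P' : Placement n m k} {s : Fin m → Fin (k + 1) → ZMod n} {u v : List ℕ}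
  {p q : Option VType} {a : VType}

theorem pos_eq_of_embed_eq (hu : nodeInfo (k + 1) t X u = some (p, a))
    (hv : nodeInfo (k + 1) t X v = some (q, a)) (ha : a ≠ .ordinary)
    (h : P.embed t X u = P'.embed t X v) : P.pos t X u = P'.pos t X v := by
  cases a with
  | ordinary => exact absurd rfl ha
  | helper => simpa [embed_helper hu, embed_helper hv] using h
  | table => simpa [embed_table hu, embed_table hv] using h

theorem pos_of_mem_heads (hu : u ∈ heads (k + 1) L t X) : P.pos t X u = P.headPos u := by
  obtain ⟨-, hhead, p, a, hp, ha⟩ := mem_heads.1 hu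
  rw [pos, frame_eq_of_head_eq_self hp ha hhead]
  cases a <;> simp [headCoord]

theorem eq_of_pos_eq_of_separated (hn : 2 * L + 2 < n)
    (hsep : Set.Pairwise (heads (k + 1) L t X) fun a b => ¬ Close L (P.headPos a) (P.headPos b))
    (hul : u.length ≤ L) (hvl : v.length ≤ L) (hu : nodeInfo (k + 1) t X u = some (p, a))
    (hv : nodeInfo (k + 1) t X v = some (q, a)) (ha : a ≠ .ordinary)
    (h : P.pos t X u = P.pos t X v) : u = v := by
  have hu_le := abs_le.1 (abs_coord_frame_le (k := k + 1) (t := t) (X := X) u)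
  have hv_le := abs_le.1 (abs_coord_frame_le (k := k + 1) (t := t) (X := X) v)
  rw [pos, pos] at h
  have hhead : (frame (k + 1) t X u).head = (frame (k + 1) t X v).head := by
    by_contra hne
    refine hsep (head_frame_mem_heads hu ha hul) (head_frame_mem_heads hv ha hvl) hne
      ⟨(frame (k + 1) t X v).coord / 2 - (frame (k + 1) t X u).coord / 2,
        abs_le.2 (by constructor <;> omega), ?_⟩
    rw [Int.cast_sub, add_sub, ← h]
    ring
  refine eq_of_frame_eq hu ha hv ha hhead ?_
  rw [hhead, add_right_inj, ← sub_eq_zero, ← Int.cast_sub,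
    ZMod.intCast_zmod_eq_zero_iff_dvd] at h
  have hhalf := Int.eq_zero_of_abs_lt_dvd h (abs_lt.2 (by constructor <;> omega))
  have hu_mod := coord_frame_emod_two hu ha
  have hv_mod := coord_frame_emod_two hv ha
  omega

theorem admissible_of_separated (hn : 2 * L + 2 < n)
    (hsep : Set.Pairwise (heads (k + 1) L t X) fun a b => ¬ Close L (P.headPos a) (P.headPos b))
    (hinj : Set.InjOn P.name (ordinaries (k + 1) L t X))
    (hlt : ∀ a ∈ ordinaries (k + 1) L t X, ∀ b ∈ ordinaries (k + 1) L t X, a.tail = b.tail →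
      a < b → P.name a < P.name b) : P.Admissible t X L := by
  refine ⟨fun u v hul hvl hu hv h => ?_, fun i j u p q hul hij hi hj => ?_⟩
  · obtain ⟨⟨p, a⟩, hu⟩ := Option.isSome_iff_exists.1 hu
    obtain ⟨⟨q, b⟩, hv⟩ := Option.isSome_iff_exists.1 hv
    obtain rfl : a = b := by rw [← gType_embed hu, h, gType_embed hv]
    by_cases ha : a = .ordinary
    · subst ha
      rw [embed_ordinary hu, embed_ordinary hv] at h
      exact hinj (mem_ordinaries.2 ⟨hul, p, hu⟩) (mem_ordinaries.2 ⟨hvl, q, hv⟩) (by simpa using h)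
    · exact eq_of_pos_eq_of_separated hn hsep hul hvl hu hv ha (pos_eq_of_embed_eq hu hv ha h)
  · exact hlt _ (mem_ordinaries (u := i :: u).2 ⟨hul, p, hi⟩) _
      (mem_ordinaries (u := j :: u).2 ⟨hul, q, hj⟩) rfl (by simpa [List.cons_lt_cons_iff] using hij)

theorem embed_eq_of_embed_nil_eq (hL : EndsWithTables (k + 1) L t X) (hA : P.Admissible t X L)
    (hA' : P'.Admissible t X L) (hR : P.Realizes t X L s) (hR' : P'.Realizes t X L s)
    (h : P.embed t X [] = P'.embed t X []) (hul : u.length ≤ L)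
    (hu : (nodeInfo (k + 1) t X u).isSome) : P.embed t X u = P'.embed t X u := by
  have hwalk := walk_embed hL hA hR hul hu
  rw [h, walk_embed hL hA' hR' hul hu] at hwalk
  exact (congrArg Prod.snd (Option.some.inj hwalk)).symm

theorem headPos_eq_of_embed_eq (hu : u ∈ heads (k + 1) L t X)
    (h : P.embed t X u = P'.embed t X u) : P.headPos u = P'.headPos u := by
  obtain ⟨-, -, p, a, hp, ha⟩ := mem_heads.1 hu
  rw [← pos_of_mem_heads hu, ← pos_of_mem_heads hu]
  exact pos_eq_of_embed_eq hp hp ha h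

theorem name_eq_of_embed_eq (hu : u ∈ ordinaries (k + 1) L t X)
    (h : P.embed t X u = P'.embed t X u) : P.name u = P'.name u := by
  obtain ⟨-, p, hp⟩ := mem_ordinaries.1 hu
  simpa [embed_ordinary hp] using h

theorem slot_eq_of_embed_eq (hL : EndsWithTables (k + 1) L t X) (hA : P.Admissible t X L)
    (hA' : P'.Admissible t X L) (hR : P.Realizes t X L s) (hR' : P'.Realizes t X L s)
    (hu : u ∈ (ordinaries (k + 1) L t X).erase []) (h : P.embed t X u = P'.embed t X u)
    (htail : P.embed t X u.tail = P'.embed t X u.tail) : P.slot u = P'.slot u := by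
  obtain ⟨hne, hu⟩ := Finset.mem_erase.1 hu
  obtain ⟨i, v, rfl⟩ := List.exists_cons_of_ne_nil hne
  obtain ⟨hul, p, hp⟩ := mem_ordinaries.1 hu
  obtain ⟨-, q, hv, -⟩ := nodeInfo_cons_eq_ordinary.1 hp
  rw [← parentSlot_name hL hA hR hul hp, ← parentSlot_name hL hA' hR' hul hp,
    name_eq_of_embed_eq hu h, pos_eq_of_embed_eq hv hv (by simp) htail]

open Classical in
theorem le_card_realizes [NeZero n] (hinj : Set.InjOn P.name (ordinaries (k + 1) L t X)) :
    (n - (tables (k + 1) L t X).card) ^ ((k + 1) * (m - (ordinaries (k + 1) L t X).card)) ≤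
      Nat.card {s // P.Realizes t X L s} := by
  let used := (ordinaries (k + 1) L t X).image P.name
  let occupied := (tables (k + 1) L t X).image (P.pos t X)
  let complete (f : {e // e ∉ used} → Fin (k + 1) → {b // b ∉ occupied}) (e : Fin m)
      (j : Fin (k + 1)) : ZMod n :=
    if h : e ∈ used then P.row t X (Finset.mem_image.1 h).choose j else f ⟨e, h⟩ j
  have hcomplete (f) : P.Realizes t X L (complete f) := by
    refine ⟨fun u p hul hp => ?_, fun e he j u hu => ?_⟩
    · have hu := mem_ordinaries.2 ⟨hul, p, hp⟩
      have h : P.name u ∈ used := Finset.mem_image_of_mem _ hu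
      ext j
      simp only [complete, dif_pos h]
      rw [hinj (Finset.mem_image.1 h).choose_spec.1 hu (Finset.mem_image.1 h).choose_spec.2]
    · have h : e ∉ used := fun h => by
        obtain ⟨v, hv, rfl⟩ := Finset.mem_image.1 h
        obtain ⟨hvl, p, hp⟩ := mem_ordinaries.1 hv
        exact he v p hvl hp rfl
      simp only [complete, dif_neg h]
      exact fun heq => (f ⟨e, h⟩ j).2 (heq ▸ Finset.mem_image_of_mem _ hu)
  have hinj' : Function.Injective fun f =>
      (⟨complete f, hcomplete f⟩ : {s // P.Realizes t X L s}) := by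
    intro f g h
    ext ⟨e, he⟩ j
    simpa only [complete, dif_neg he] using congrFun (congrFun (congrArg Subtype.val h) e) j
  refine le_trans ?_ (Nat.card_le_card_of_injective _ hinj')
  have hused : used.card = (ordinaries (k + 1) L t X).card := Finset.card_image_of_injOn hinj
  have hunused : Nat.card {e // e ∉ used} = m - (ordinaries (k + 1) L t X).card := by
    rw [Nat.card_eq_fintype_card, Fintype.card_subtype_compl, Fintype.card_coe, hused,
      Fintype.card_fin]
  have hfree : Nat.card {b // b ∉ occupied} = n - occupied.card := by
    rw [Nat.card_eq_fintype_card, Fintype.card_subtype_compl, Fintype.card_coe, ZMod.card]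
  rw [Nat.card_fun, Nat.card_fun, hunused, hfree, Nat.card_fin, ← pow_mul]
  gcongr
  exact Finset.card_image_le

end Placement

/-- The outcomes of the random choices behind a finite random graph: the elements of the ordinary
edges and the root. -/
abbrev Outcome (n m k : ℕ) : Type := (Fin m → Fin k → ZMod n) × GVertex n m

/-- Up to depth `L`, the unfolding of the outcome has no collisions, and it is the tree with root
type `t` and offspring numbers `X`. -/
def UnfoldsTo (L : ℕ) (t : VType) (X : List ℕ → ℕ) (ω : Outcome n m (k + 1)) : Prop :=
  WalkInjective ω.1 ω.2 L ∧ gType ω.2 = t ∧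
    ∀ u ∈ tables (k + 1) L t X, offspring ω.1 ω.2 u = X u

theorem Placement.unfoldsTo {P : Placement n m k} {s : Fin m → Fin (k + 1) → ZMod n}
    (hL : EndsWithTables (k + 1) L t X) (hA : P.Admissible t X L) (hR : P.Realizes t X L s) :
    UnfoldsTo L t X (s, P.embed t X []) :=
  ⟨walkInjective_embed hL hA hR, gType_embed (p := none) rfl,
    fun _ hu => offspring_embed hL hA hR hu⟩

variable (n m k L t X) in
/-- The positions of the heads of the clusters such that no two clusters intersect. -/
abbrev HeadPositions : Type :=
  {q : heads (k + 1) L t X → ZMod n // Pairwise fun a b => ¬ Close L (q a) (q b)}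

variable (n m k L t X) in
/-- The injective assignments of ordinary edges to the vertices of type `A_R` that are increasing
on siblings. -/
abbrev EdgeNames : Type :=
  {e : ordinaries (k + 1) L t X → Fin m //
    Function.Injective e ∧ ∀ ⦃a b⦄, a.1.tail = b.1.tail → a < b → e a < e b}

variable (n m k L t X) in
/-- The choices that determine an admissible placement of the vertices of depth at most `L`. -/
abbrev PlacementChoice : Type :=
  HeadPositions n k L t X × EdgeNames m k L t X ×
    ((ordinaries (k + 1) L t X).erase [] → Fin (k + 1))

namespace PlacementChoice

variable [NeZero m]

/-- The placement given by a choice, with junk values outside of the tree. -/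
noncomputable def toPlacement (x : PlacementChoice n m k L t X) : Placement n m k where
  headPos := Function.extend Subtype.val x.1.1 0
  name := Function.extend Subtype.val x.2.1.1 0
  slot := Function.extend Subtype.val x.2.2 0

theorem headPos_toPlacement (x : PlacementChoice n m k L t X) (u : heads (k + 1) L t X) :
    (toPlacement x).headPos u = x.1.1 u :=
  Subtype.val_injective.extend_apply _ _ u

theorem name_toPlacement (x : PlacementChoice n m k L t X) (u : ordinaries (k + 1) L t X) :
    (toPlacement x).name u = x.2.1.1 u :=
  Subtype.val_injective.extend_apply _ _ u

theorem slot_toPlacement (x : PlacementChoice n m k L t X)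
    (u : (ordinaries (k + 1) L t X).erase []) : (toPlacement x).slot u = x.2.2 u :=
  Subtype.val_injective.extend_apply _ _ u

theorem injOn_name_toPlacement (x : PlacementChoice n m k L t X) :
    Set.InjOn (toPlacement x).name (ordinaries (k + 1) L t X) := by
  intro a ha b hb h
  rw [name_toPlacement x ⟨a, ha⟩, name_toPlacement x ⟨b, hb⟩] at h
  exact congrArg Subtype.val (x.2.1.2.1 h)

theorem admissible_toPlacement (hn : 2 * L + 2 < n) (x : PlacementChoice n m k L t X) :
    (toPlacement x).Admissible t X L := by
  refine Placement.admissible_of_separated hn ?_ (injOn_name_toPlacement x) ?_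
  · intro a ha b hb hab
    rw [headPos_toPlacement x ⟨a, ha⟩, headPos_toPlacement x ⟨b, hb⟩]
    exact x.1.2 (by simpa using hab)
  · intro a ha b hb htail hab
    rw [name_toPlacement x ⟨a, ha⟩, name_toPlacement x ⟨b, hb⟩]
    exact x.2.1.2.2 htail hab

theorem eq_of_embed_nil_eq (hL : EndsWithTables (k + 1) L t X) (hn : 2 * L + 2 < n)
    {x x' : PlacementChoice n m k L t X} {s : Fin m → Fin (k + 1) → ZMod n}
    (hR : (toPlacement x).Realizes t X L s) (hR' : (toPlacement x').Realizes t X L s)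
    (h : (toPlacement x).embed t X [] = (toPlacement x').embed t X []) : x = x' := by
  have hA := admissible_toPlacement hn x
  have hA' := admissible_toPlacement hn x'
  have hembed {u} := Placement.embed_eq_of_embed_nil_eq (u := u) hL hA hA' hR hR' h
  have hord {u} (hu : u ∈ ordinaries (k + 1) L t X) :
      (toPlacement x).embed t X u = (toPlacement x').embed t X u := by
    obtain ⟨hul, p, hp⟩ := mem_ordinaries.1 hu
    exact hembed hul (by simp [hp])
  refine Prod.ext (Subtype.ext (funext fun u => ?_))
    (Prod.ext (Subtype.ext (funext fun u => ?_)) (funext fun u => ?_))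
  · obtain ⟨hul, -, p, a, hp, -⟩ := mem_heads.1 u.2
    rw [← headPos_toPlacement, ← headPos_toPlacement]
    exact Placement.headPos_eq_of_embed_eq u.2 (hembed hul (by simp [hp]))
  · rw [← name_toPlacement, ← name_toPlacement]
    exact Placement.name_eq_of_embed_eq u.2 (hord u.2)
  · obtain ⟨hne, hu⟩ := Finset.mem_erase.1 u.2
    obtain ⟨hul, p, hp⟩ := mem_tables.1 (tail_mem_tables hu hne)
    rw [← slot_toPlacement, ← slot_toPlacement]
    exact Placement.slot_eq_of_embed_eq hL hA hA' hR hR' u.2 (hord hu)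
      (hembed hul.le (by simp [hp]))

end PlacementChoice

theorem card_sub_pow_le_card_headPositions [NeZero n] :
    (n - (heads (k + 1) L t X).card * (4 * L + 5)) ^ (heads (k + 1) L t X).card ≤
      Nat.card (HeadPositions n k L t X) := by
  simpa only [ZMod.card, Fintype.card_coe] using
    card_sub_pow_le_card_separated (ι := heads (k + 1) L t X) (card_close_le (n := n) (L := L))

theorem descFactorial_le_card_edgeNames :
    m.descFactorial (ordinaries (k + 1) L t X).card ≤
      Nat.card (EdgeNames m k L t X) * ∏ v ∈ tables (k + 1) L t X, (X v).factorial := by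
  have h := descFactorial_le_card_increasing (M := Fin m)
    fun u : ordinaries (k + 1) L t X => u.1.tail
  rw [Fintype.card_coe, Fintype.card_fin] at h
  exact h.trans (Nat.mul_le_mul_left _ prod_card_siblings_factorial_le)

theorem card_placementChoice_mul_le [NeZero n] [NeZero m] (hL : EndsWithTables (k + 1) L t X)
    (hn : 2 * L + 2 < n) :
    Nat.card (PlacementChoice n m k L t X) *
        (n - (tables (k + 1) L t X).card) ^ ((k + 1) * (m - (ordinaries (k + 1) L t X).card)) ≤
      Nat.card {ω : Outcome n m (k + 1) // UnfoldsTo L t X ω} := by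
  have hinj : Function.Injective
      fun y : Σ x : PlacementChoice n m k L t X, {s // x.toPlacement.Realizes t X L s} =>
        (⟨(y.2.1, y.1.toPlacement.embed t X []),
          Placement.unfoldsTo hL (PlacementChoice.admissible_toPlacement hn y.1) y.2.2⟩ :
          {ω : Outcome n m (k + 1) // UnfoldsTo L t X ω}) := by
    rintro ⟨x, s, hR⟩ ⟨x', s', hR'⟩ h
    simp only [Subtype.mk.injEq, Prod.mk.injEq] at h
    obtain ⟨rfl, h⟩ := h
    obtain rfl := PlacementChoice.eq_of_embed_nil_eq hL hn hR hR' h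
    rfl
  refine le_trans ?_ (Nat.card_le_card_of_injective _ hinj)
  have := Fintype.ofFinite (PlacementChoice n m k L t X)
  rw [Nat.card_sigma, Nat.card_eq_fintype_card, ← smul_eq_mul]
  exact Finset.card_nsmul_le_sum _ _ _ fun x _ =>
    Placement.le_card_realizes x.injOn_name_toPlacement

theorem le_card_unfoldsTo [NeZero n] [NeZero m] (hL : EndsWithTables (k + 1) L t X)
    (hn : 2 * L + 2 < n) :
    (n - (heads (k + 1) L t X).card * (4 * L + 5)) ^ (heads (k + 1) L t X).card *
        m.descFactorial (ordinaries (k + 1) L t X).card *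
        (k + 1) ^ ((ordinaries (k + 1) L t X).erase []).card *
        (n - (tables (k + 1) L t X).card) ^ ((k + 1) * (m - (ordinaries (k + 1) L t X).card)) ≤
      Nat.card {ω : Outcome n m (k + 1) // UnfoldsTo L t X ω} *
        ∏ v ∈ tables (k + 1) L t X, (X v).factorial := by
  have hslots : Nat.card ((ordinaries (k + 1) L t X).erase [] → Fin (k + 1)) =
      (k + 1) ^ ((ordinaries (k + 1) L t X).erase []).card := by
    rw [Nat.card_fun, Nat.card_fin, Nat.card_eq_fintype_card, Fintype.card_coe]
  set F := ∏ v ∈ tables (k + 1) L t X, (X v).factorial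
  set N := (n - (tables (k + 1) L t X).card) ^ ((k + 1) * (m - (ordinaries (k + 1) L t X).card))
  calc _ ≤ Nat.card (HeadPositions n k L t X) * (Nat.card (EdgeNames m k L t X) * F) *
        Nat.card ((ordinaries (k + 1) L t X).erase [] → Fin (k + 1)) * N := by
        rw [hslots]
        gcongr
        · exact card_sub_pow_le_card_headPositions
        · exact descFactorial_le_card_edgeNames
    _ = Nat.card (PlacementChoice n m k L t X) * N * F := by
        rw [Nat.card_prod, Nat.card_prod]
        ring
    _ ≤ _ := Nat.mul_le_mul_right _ (card_placementChoice_mul_le hL hn)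

end Placements

/-! ### Asymptotics -/

section Asymptotics

variable {c : ℝ} {m : ℕ → ℕ}

theorem tendsto_atTop_of_tendsto_div (hc : 0 < c)
    (hm : Tendsto (fun n : ℕ => (m n : ℝ) / n) atTop (𝓝 c)) : Tendsto m atTop atTop := by
  rw [← tendsto_natCast_atTop_iff (R := ℝ)]
  refine (hm.pos_mul_atTop hc tendsto_natCast_atTop_atTop).congr' ?_
  filter_upwards [eventually_ne_atTop 0] with n hn
  exact div_mul_cancel₀ _ (Nat.cast_ne_zero.2 hn)

theorem tendsto_sub_div (hc : 0 < c) (hm : Tendsto (fun n : ℕ => (m n : ℝ) / n) atTop (𝓝 c))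
    (a : ℕ) : Tendsto (fun n : ℕ => ((m n - a : ℕ) : ℝ) / n) atTop (𝓝 c) := by
  have h := hm.sub (tendsto_const_div_atTop_nhds_zero_nat (a : ℝ))
  rw [sub_zero] at h
  refine h.congr' ?_
  filter_upwards [(tendsto_atTop_of_tendsto_div hc hm).eventually_ge_atTop a] with n hn
  rw [Nat.cast_sub hn, sub_div]

theorem tendsto_sub_div_self (a : ℕ) :
    Tendsto (fun n : ℕ => ((n - a : ℕ) : ℝ) / n) atTop (𝓝 1) := by
  refine tendsto_sub_div one_pos (m := fun n => n) (tendsto_const_nhds.congr' ?_) a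
  filter_upwards [eventually_ne_atTop 0] with n hn
  exact (div_self (Nat.cast_ne_zero.2 hn)).symm

theorem tendsto_sub_div_self_pow (b : ℕ) (hm : Tendsto (fun n : ℕ => (m n : ℝ) / n) atTop (𝓝 c)) :
    Tendsto (fun n : ℕ => (((n - b : ℕ) : ℝ) / n) ^ m n) atTop (𝓝 (Real.exp (-(b * c)))) := by
  have h := (Real.tendsto_one_add_div_pow_exp (-(b : ℝ))).rpow hm (.inl (Real.exp_pos _).ne')
  rw [← Real.exp_mul, neg_mul] at h
  refine h.congr' ?_
  filter_upwards [eventually_ne_atTop 0, eventually_ge_atTop b] with n hn hb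
  have hn' : (n : ℝ) ≠ 0 := Nat.cast_ne_zero.2 hn
  have hbase : 1 + -(b : ℝ) / n = ((n - b : ℕ) : ℝ) / n := by
    rw [Nat.cast_sub hb]
    field_simp
    ring
  rw [hbase, ← Real.rpow_natCast, ← Real.rpow_mul (by positivity), mul_div_cancel₀ _ hn',
    Real.rpow_natCast]

theorem tendsto_div_card_vertices (hc : 0 < c)
    (hm : Tendsto (fun n : ℕ => (m n : ℝ) / n) atTop (𝓝 c)) :
    Tendsto (fun n : ℕ => (n : ℝ) / (n + m n + n)) atTop (𝓝 (1 / (2 + c))) := by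
  have h : Tendsto (fun n : ℕ => 1 / (2 + (m n : ℝ) / n)) atTop (𝓝 (1 / (2 + c))) :=
    tendsto_const_nhds.div (tendsto_const_nhds.add hm) (by positivity)
  refine h.congr' ?_
  filter_upwards [eventually_ne_atTop 0] with n hn
  have hn' : (n : ℝ) ≠ 0 := Nat.cast_ne_zero.2 hn
  field_simp
  ring

theorem tendsto_count_div_card_outcomes (hc : 0 < c)
    (hm : Tendsto (fun n : ℕ => (m n : ℝ) / n) atTop (𝓝 c)) (k a o b : ℕ) :
    Tendsto (fun n : ℕ => ((n - a : ℕ) : ℝ) ^ (1 + k * o) * ((m n - o : ℕ) : ℝ) ^ o *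
        ((n - b : ℕ) : ℝ) ^ ((k + 1) * (m n - o)) / (((n : ℝ) ^ (k + 1)) ^ m n * (n + m n + n)))
      atTop (𝓝 (c ^ o * Real.exp (-(b * ((k + 1) * c))) * (1 / (2 + c)))) := by
  have hexp : Tendsto (fun n : ℕ => (((k + 1) * (m n - o) : ℕ) : ℝ) / n) atTop
      (𝓝 ((k + 1) * c)) := by
    simpa only [Nat.cast_mul, Nat.cast_succ, mul_div_assoc] using
      (tendsto_sub_div hc hm o).const_mul ((k : ℝ) + 1)
  have hlim := ((((tendsto_sub_div_self a).pow (1 + k * o)).mul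
    ((tendsto_sub_div hc hm o).pow o)).mul (tendsto_sub_div_self_pow b hexp)).mul
    (tendsto_div_card_vertices hc hm)
  rw [one_pow, one_mul] at hlim
  refine hlim.congr' ?_
  filter_upwards [eventually_gt_atTop 0,
    (tendsto_atTop_of_tendsto_div hc hm).eventually_ge_atTop o] with n hn ho
  have hn' : (n : ℝ) ≠ 0 := by positivity
  have hpow : ((n : ℝ) ^ (k + 1)) ^ m n * n =
      (n : ℝ) ^ (1 + k * o) * (n : ℝ) ^ o * (n : ℝ) ^ ((k + 1) * (m n - o)) := by
    rw [← pow_mul, ← pow_succ, ← pow_add, ← pow_add]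
    congr 1
    obtain ⟨j, hj⟩ := Nat.exists_eq_add_of_le ho
    rw [hj, Nat.add_sub_cancel_left]
    ring
  rw [div_pow, div_pow, div_pow, div_mul_div_comm, div_mul_div_comm, div_mul_div_comm, ← hpow,
    mul_right_comm _ (n : ℝ), mul_div_mul_right _ _ hn']

end Asymptotics

/-! ### The probability of a shape -/

section Limit

variable {k d : ℕ}

theorem eq_table_iff_of_nodeInfo {t : VType} {X : List ℕ → ℕ} {u : List ℕ} {p : Option VType}
    {a : VType} (h : nodeInfo k t X u = some (p, a)) :
    a = .table ↔ (Even u.length ↔ t = .table) := by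
  induction u generalizing p a with
  | nil =>
    obtain ⟨-, rfl⟩ : none = p ∧ t = a := by simpa [nodeInfo] using h
    simp
  | cons i u ih =>
    have hparent : ∃ q b, nodeInfo k t X u = some (q, b) ∧ (a = .table ↔ b ≠ .table) := by
      cases a with
      | helper =>
        obtain ⟨-, q, hq, -⟩ := nodeInfo_cons_eq_helper.1 h
        exact ⟨q, _, hq, by simp⟩
      | ordinary =>
        obtain ⟨-, q, hq, -⟩ := nodeInfo_cons_eq_ordinary.1 h
        exact ⟨q, _, hq, by simp⟩
      | table =>
        obtain ⟨-, q, hq, -⟩ | ⟨-, q, hq, -⟩ := nodeInfo_cons_eq_table.1 h <;>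
          exact ⟨q, _, hq, by simp⟩
    obtain ⟨q, b, hq, hab⟩ := hparent
    rw [hab, ne_eq, ih hq, List.length_cons, Nat.even_add_one]
    tauto

theorem endsWithTables_levelOf (t : VType) (X : List ℕ → ℕ) :
    EndsWithTables k (levelOf d t) t X := by
  intro u p a hu h
  rw [eq_table_iff_of_nodeInfo h, hu]
  cases t <;> simp [levelOf, Nat.even_add]

theorem unfoldsTo_iff {n m : ℕ} {y : TreePrefix (k + 1) d} {ω : Outcome n m (k + 1)} :
    UnfoldsTo y.depth y.rootType y.offspring ω ↔
      WalkInjective ω.1 ω.2 (levelOf d (gType ω.2)) ∧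
        prefixOf (k + 1) d (gType ω.2) (offspring ω.1 ω.2) = y := by
  rw [TreePrefix.prefixOf_eq_iff, UnfoldsTo]
  exact ⟨fun ⟨hW, ht, hX⟩ => ⟨by rwa [ht], ht, hX⟩, fun ⟨hW, ht, hX⟩ => ⟨by rwa [ht] at hW, ht, hX⟩⟩

theorem card_outcome (n m k : ℕ) [NeZero n] :
    Nat.card (Outcome n m k) = (n ^ k) ^ m * (n + m + n) := by
  simp [Nat.card_eq_fintype_card, ZMod.card]

theorem prod_poisson {ι : Type*} (s : Finset ι) (x : ι → ℕ) (r : ℝ) :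
    ∏ u ∈ s, (Real.exp (-r) * r ^ x u / (x u).factorial) =
      Real.exp (-(s.card * r)) * r ^ (∑ u ∈ s, x u) / ((∏ u ∈ s, (x u).factorial : ℕ) : ℝ) := by
  rw [Finset.prod_div_distrib, Finset.prod_mul_distrib, Finset.prod_const,
    Finset.prod_pow_eq_pow_sum, ← Real.exp_nat_mul, Nat.cast_prod, mul_neg]

theorem rootProb_mul_pow (c : ℝ≥0) (L : ℕ) (t : VType) (X : List ℕ → ℕ) :
    rootProb c t * (c : ℝ) ^ ((ordinaries k L t X).erase []).card =
      (c : ℝ) ^ (ordinaries k L t X).card * (1 / (2 + c)) := by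
  by_cases ht : t = .ordinary
  · rw [← Finset.card_erase_add_one (nil_mem_ordinaries (k := k) (L := L) (X := X).2 ht), pow_succ,
      ht, rootProb]
    ring
  · rw [Finset.erase_eq_of_notMem (mt nil_mem_ordinaries.1 ht)]
    have hroot : rootProb c t = 1 / (2 + c) := by
      cases t with
      | ordinary => exact absurd rfl ht
      | _ => rfl
    rw [hroot, mul_comm]

theorem treeLaw_real_prefixEvent_eq (c : ℝ≥0) (y : TreePrefix k d) :
    (treeLaw k c).real (prefixEvent y) =
      (k : ℝ) ^ ((ordinaries k y.depth y.rootType y.offspring).erase []).card /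
        ((∏ v ∈ y.tables, (y.offspring v).factorial : ℕ) : ℝ) *
      ((c : ℝ) ^ (ordinaries k y.depth y.rootType y.offspring).card *
        Real.exp (-(y.tables.card * (k * c))) * (1 / (2 + c))) := by
  have hroot := rootProb_mul_pow (k := k) c y.depth y.rootType y.offspring
  rw [treeLaw_real_prefixEvent, prod_poisson, ← card_ordinaries_erase_nil, mul_pow,
    mul_right_comm ((c : ℝ) ^ _), ← hroot]
  ring

theorem eventually_le_card_unfoldsTo_div {c : ℝ≥0} (hc : 0 < c) {m : ℕ → ℕ}
    (hm : Tendsto (fun n : ℕ => (m n : ℝ) / n) atTop (𝓝 (c : ℝ)))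
    (y : TreePrefix (k + 1) d) {x : ℝ} (hx : x < (treeLaw (k + 1) c).real (prefixEvent y)) :
    ∀ᶠ n in atTop, x ≤ (Nat.card {ω : Outcome n (m n) (k + 1) //
      UnfoldsTo y.depth y.rootType y.offspring ω} : ℝ) / Nat.card (Outcome n (m n) (k + 1)) := by
  have hL := endsWithTables_levelOf (k := k + 1) (d := d) y.rootType y.offspring
  rw [treeLaw_real_prefixEvent_eq, Nat.cast_succ] at hx
  set o := (ordinaries (k + 1) y.depth y.rootType y.offspring).card
  set r := ((ordinaries (k + 1) y.depth y.rootType y.offspring).erase []).card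
  set F := ∏ v ∈ y.tables, (y.offspring v).factorial
  have hF : (0 : ℝ) < F := Nat.cast_pos.2 (Finset.prod_pos fun v _ => Nat.factorial_pos _)
  have hlim := (tendsto_count_div_card_outcomes (NNReal.coe_pos.2 hc) hm k
    ((1 + k * o) * (4 * y.depth + 5)) o y.tables.card).const_mul ((k + 1 : ℝ) ^ r / F)
  filter_upwards [hlim.eventually (lt_mem_nhds hx), eventually_gt_atTop (2 * y.depth + 2),
    (tendsto_atTop_of_tendsto_div (NNReal.coe_pos.2 hc) hm).eventually_gt_atTop 0]
    with n hxn hn hmn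
  have : NeZero n := ⟨by omega⟩
  have : NeZero (m n) := ⟨hmn.ne'⟩
  have hcount := le_card_unfoldsTo (n := n) (m := m n) hL hn
  rw [card_heads hL] at hcount
  have hdesc : (m n - o) ^ o ≤ (m n).descFactorial o :=
    (Nat.pow_le_pow_left (by omega) _).trans (Nat.pow_sub_le_descFactorial _ _)
  refine hxn.le.trans ?_
  rw [card_outcome, ← mul_div_assoc, Nat.cast_mul]
  push_cast
  refine div_le_div_of_nonneg_right ?_ (by positivity)
  rw [div_mul_eq_mul_div, div_le_iff₀ hF]
  calc _ = (((n - (1 + k * o) * (4 * y.depth + 5)) ^ (1 + k * o) * (m n - o) ^ o * (k + 1) ^ r *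
        (n - y.tables.card) ^ ((k + 1) * (m n - o)) : ℕ) : ℝ) := by
        push_cast
        ring
    _ ≤ _ := by
        rw [← Nat.cast_mul, Nat.cast_le]
        exact le_trans (by gcongr) hcount

end Limit

section Limit

variable {n m k d : ℕ} {s : Fin m → Fin (k + 1) → ZMod n} {r : GVertex n m}

theorem WalkInjective.mono {L L' : ℕ} (h : WalkInjective s r L') (hL : L ≤ L') :
    WalkInjective s r L :=
  fun _ _ _ _ _ hu hv => h (hu.trans hL) (hv.trans hL)

theorem WalkInjective.isom_ball_prefixOf (ℓ : ℕ) (h : WalkInjective s r (levelOf d (gType r)))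
    (hn : 2 ≤ n) :
    RootedGraph.Isom True True True
      ((tree (k + 1) ℓ (prefixOf (k + 1) d (gType r) (offspring s r)).rootType
        (prefixOf (k + 1) d (gType r) (offspring s r)).offspring).ball d)
      ((incidenceGraph ℓ s r).ball d) :=
  (TreePrefix.isom_ball_prefixOf ℓ _ _).symm.trans ((h.mono (lt_levelOf d _)).isom_ball hn)

end Limit

end CuckooWindows

open CuckooWindows in
theorem mainTheorem6_general (k ℓ : ℕ) (hk : 1 ≤ k) (c : ℝ≥0) (hc : 0 < c)
    (m : ℕ → ℕ) (hm : Tendsto (fun n : ℕ => (m n : ℝ) / (n : ℝ)) atTop (𝓝 (c : ℝ))) (d : ℕ)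
    (P : RootedGraph → Prop) (hP : RootedGraph.IsomInvariant P) :
    Tendsto (fun n : ℕ => graphProb n (m n) k ℓ fun R => P (R.ball d)) atTop
      (𝓝 (treeProb k ℓ c fun R => P (R.ball d))) := by
  obtain ⟨k, rfl⟩ := Nat.exists_eq_add_of_le' hk
  rw [treeProb_ball_eq ℓ c hP]
  refine tendsto_of_hasSum_one (hasSum_prefixEvent c) (hasSum_indicator_prefixEvent c _)
    (fun y _ => eventually_le_card_unfoldsTo_div hc hm y) ?_ ?_
  all_goals
    filter_upwards [eventually_ge_atTop 2] with n hn F hF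
    have : NeZero n := ⟨by omega⟩
    simp only [unfoldsTo_iff]
  · exact sum_card_fiber_div_le fun ω hω hωF =>
      (hP.iff (hω.isom_ball_prefixOf ℓ hn)).1 (hF hωF)
  · rw [graphProb, ← card_not_div_eq_one_sub]
    exact sum_card_fiber_div_le fun ω hω hωF =>
      mt (hP.iff (hω.isom_ball_prefixOf ℓ hn)).2 (hF hωF)

open CuckooWindows in
theorem mainTheorem6 (k ℓ : ℕ) (hk : 2 ≤ k) (hℓ : 2 ≤ ℓ) (c : ℝ≥0) (hc : 0 < c)
    (m : ℕ → ℕ) (hm : Tendsto (fun n : ℕ => (m n : ℝ) / (n : ℝ)) atTop (𝓝 (c : ℝ)))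
    (keepMult keepType keepWeight : Prop) (d : ℕ) (H : RootedGraph) :
    Tendsto
      (fun n : ℕ => graphProb n (m n) k ℓ
        (fun R => RootedGraph.Isom keepMult keepType keepWeight (R.ball d) H))
      atTop
      (𝓝 (treeProb k ℓ c
        (fun R => RootedGraph.Isom keepMult keepType keepWeight (R.ball d) H))) :=
  mainTheorem6_general k ℓ (by omega) c hc m hm d
    (fun R => RootedGraph.Isom keepMult keepType keepWeight R H)
    (RootedGraph.isomInvariant_isom keepMult keepType keepWeight H)
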